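/- Let $D\ge 2$, let $\eta=\mathrm{diag}(-1,1,\dots,1)$ be the Minkowski metric on $\mathbb R^D$, $\sigma(x)=\eta_{\mu\nu}x^\mu x^\nu$, $m^2\in\mathbb R$ and $K=-\eta^{\mu\nu}\partial_\mu\partial_\nu+m^2$. Let $H_F(x_1,x_2)=E(x_1-x_2)$, $E\in\mathcal D'(\mathbb R^D;\mathbb C)$, be a translation-invariant Feynman parametrix of $K$; that is, in the sense of distributions, $$E=\lim_{\varepsilon\to0^+}\Big(\frac{U}{(\sigma+i\varepsilon)^{D/2-1}}+V\log\frac{\sigma+i\varepsilon}{\ell^{2}}\Big)+W$$ with $\ell>0$, smooth functions $U,V,W:\mathbb R^D\to\mathbb C$, $V=0$ if $D$ is odd, and principal branches, and $KE=-i\delta+h$ with $h$ smooth (every Poincaré-invariant Feynman parametrix is of this kind). Let $z\in\mathbb R^D$, let $\mathcal B_1,\mathcal B_2$ be compact neighborhoods of $z$, and let $\chi\in C^\infty(\mathbb R^D,\mathbb R)$ satisfy $\chi=1$ on $\mathcal B_1$ and $\chi=0$ outside $\mathcal B_2$. Assume that no null geodesic leaves $\mathcal B_1$ and returns to it: if $x,y\in\mathcal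 B_1$ and $\sigma(y-x)=0$, then the segment from $x$ to $y$ lies in $\mathcal B_1$ (for example, $\mathcal B_1$ is a ball). For every real test function $f$ the function $y\mapsto H_F(y,f)=\int d^Dx\,H_F(y,x)f(x)$ is smooth, so that $$\Theta(f_1,f_2)=\int_{\mathcal B_2\setminus\mathcal B_1}d^Dy\;\partial_\mu\chi(y)\,H_F(y,f_1)\,\partial^\mu_{(y)}H_F(y,f_2)$$ defines a bi-distribution $\Theta(x_1,x_2)=\int_{\mathcal B_2\setminus\mathcal B_1}d^Dy\,\partial_\mu\chi(y)\,H_F(y,x_1)\,\partial^\mu_{(y)}H_F(y,x_2)$. Then $\Theta$ is a $C^\infty$ function of $(x_1,x_2)$ for $x_1,x_2$ in the interior of $\mathcal B_1$: there is a function $\theta$, smooth on $\operatorname{int}\mathcal B_1\times\operatorname{int}\mathcal B_1$, with $$\Theta(f_1,f_2)=\int\!\!\int\theta(x_1,x_2)f_1(x_1)f_2(x_2)\,d^Dx_1\,d^Dx_2$$ for all real test functions $f_1,f_2$ supported in $\operatorname{int}\mathcal B_1$. -/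

import Mathlib

open Set Filter Topology MeasureTheory TopologicalSpace
open scoped Distributions LineDeriv ContDiff

noncomputable section

namespace MinkowskiFlow

/-- Points of `D`-dimensional Minkowski spacetime, `D = d + 1`, in a global inertial coordinate
system. Coordinate `0` is time; the measure is Lebesgue measure `d^D y`. -/
abbrev Spacetime (d : ℕ) : Type := EuclideanSpace ℝ (Fin (d + 1))

/-- Test functions on spacetime. -/
abbrev Test (d : ℕ) : Type := 𝓓((⊤ : Opens (Spacetime d)), ℝ)

/-- Complex-valued distributions on spacetime. -/
abbrev Distr (d : ℕ) : Type := 𝓓'((⊤ : Opens (Spacetime d)), ℂ)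

/-- Diagonal entries of the Minkowski metric `diag(-1, 1, …, 1)`, which is its own inverse. -/
def eta {d : ℕ} (μ : Fin (d + 1)) : ℝ := if μ = 0 then -1 else 1

/-- The coordinate basis vectors. -/
def basisVec {d : ℕ} (μ : Fin (d + 1)) : Spacetime d := EuclideanSpace.single μ 1

/-- The squared geodesic distance `η_{μν} x^μ x^ν` of `x` from the origin. -/
def sigma {d : ℕ} (x : Spacetime d) : ℝ := ∑ μ, eta μ * x μ ^ 2

/-- The Klein-Gordon operator `K = -η^{μν} ∂_μ ∂_ν + m²` on distributions. -/
def kleinGordon {d : ℕ} (m2 : ℝ) (E : Distr d) : Distr d :=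
  -(∑ μ : Fin (d + 1), eta μ • ∂_{basisVec μ} (∂_{basisVec μ} E)) + m2 • E

/-- The regularized Hadamard form
`U / (σ + iε)^{D/2-1} + V log (ℓ⁻² (σ + iε)) + W`, with `D = d + 1` and principal branches. -/
def regularizedKernel {d : ℕ} (U V W : Spacetime d → ℂ) (ℓ ε : ℝ) (x : Spacetime d) : ℂ :=
  U x / ((sigma x : ℂ) + Complex.I * ε) ^ (((d + 1 : ℕ) : ℂ) / 2 - 1)
    + V x * Complex.log (((sigma x : ℂ) + Complex.I * ε) / (ℓ : ℂ) ^ 2)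
    + W x

/-- `E` defines a translation-invariant Feynman parametrix `H_F(x₁, x₂) = E(x₁ - x₂)` of the
Klein-Gordon operator with squared mass `m2`: it has the Hadamard form with the Feynman
`i0⁺`-prescription and smooth `U`, `V`, `W` (with `V = 0` if `D` is odd), and
`K H_F = -i δ + smooth`. Poincare-invariant parametrices are a special case. -/
structure IsFeynmanParametrix {d : ℕ} (m2 : ℝ) (E : Distr d) : Prop where
  hadamard_form : ∃ (U V W : Spacetime d → ℂ) (ℓ : ℝ),
    ContDiff ℝ ∞ U ∧ ContDiff ℝ ∞ V ∧ ContDiff ℝ ∞ W ∧ 0 < ℓ ∧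
    (Odd (d + 1) → V = 0) ∧
    ∀ f : Test d,
      Tendsto (fun ε : ℝ => ∫ x, regularizedKernel U V W ℓ ε x * (f x : ℂ)) (𝓝[>] 0) (𝓝 (E f))
  parametrix : ∃ h : Spacetime d → ℂ, ContDiff ℝ ∞ h ∧
    ∀ f : Test d,
      kleinGordon m2 E f = -Complex.I * (f 0 : ℂ) + ∫ x, h x * (f x : ℂ)

/-- The test function `w ↦ f (y - w)`. -/
def reflectTranslate {d : ℕ} (y : Spacetime d) (f : Test d) : Test d where
  toFun w := f (y - w)
  contDiff' := f.contDiff.comp (contDiff_const.sub contDiff_id)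
  hasCompactSupport' := f.hasCompactSupport.comp_homeomorph (Homeomorph.subLeft y)
  tsupport_subset' := fun _ _ => trivial

/-- The distribution `H_F(y, x) = E(y - x)` smeared in its second variable,
`H_F(y, f) = ∫ d^D x H_F(y, x) f(x)`, as a function of `y`. -/
def smeared {d : ℕ} (E : Distr d) (f : Test d) (y : Spacetime d) : ℂ :=
  E (reflectTranslate y f)

/-- The bi-distribution
`Θ(x₁, x₂) = ∫_{B₂ ∖ B₁} d^D y ∂_μ χ(y) H_F(y, x₁) ∂^μ_{(y)} H_F(y, x₂)`,
smeared with `f₁` in `x₁` and with `f₂` in `x₂`. -/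
def boundaryIntegral {d : ℕ} (E : Distr d) (χ : Spacetime d → ℝ) (B₁ B₂ : Set (Spacetime d))
    (f₁ f₂ : Test d) : ℂ :=
  ∫ y in B₂ \ B₁, ∑ μ : Fin (d + 1),
    (fderiv ℝ χ y (basisVec μ) : ℂ) * smeared E f₁ y *
      ((eta μ : ℂ) * fderiv ℝ (smeared E f₂) y (basisVec μ))

/-- `B` contains the null geodesic segment between any two of its points that are null related:
no null geodesic leaves `B` and comes back. -/
def NullConvex {d : ℕ} (B : Set (Spacetime d)) : Prop :=
  ∀ x ∈ B, ∀ y ∈ B, sigma (y - x) = 0 → segment ℝ x y ⊆ B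

end MinkowskiFlow

end

noncomputable section

namespace MinkowskiFlow

/-! ### Parametric integrals over compact sets -/

section ParametricIntegral

variable {P X V : Type*} [TopologicalSpace X] [NormedAddCommGroup V]

/-! For `ε > 0` the regularized kernel is a finite sum of smooth coefficients times `F(σ + iε)`,
where `F` is holomorphic on the upper half plane, extends across the punctured real axis and grows
at most polynomially in `1 / Im`. So everything reduces to the limit `ε → 0⁺` of `∫ A(y, x) F₁(σ(y -
x₁) + iε) F₂(σ(y - x₂) + iε) dy` with `A` smooth and compactly supported in `y`.

Moving `y` to `y + iτv` adds `2τ⟨v, w⟩` to the imaginary part of `σ(w)`. If one `v` has `⟨v, y - x₁⟩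
> 0` and `⟨v, y - x₂⟩ > 0`, both factors become regular together. The amplitude is not analytic, so
the contour cannot simply be moved. Instead, the Cauchy-Riemann equations and an integration by
parts in `y` give `∂_τ I(A, τ) = -i I(∂_v A, τ)` (`hasDerivAt_shiftedIntegral`). Since `|I(A, τ)| ≤
D τ^(-N)` with `N` independent of `A`, the moments `∫₀¹ τ^k I dτ` converge for `k ≥ N`. Integration
by parts in `τ` descends to `k = 0` and then to `I(A, 0)` (`convergesAt_of_polar_pos`).

The geometric point is `NullConvex.isRegularPair`. With `y` outside the interior of `B₁` and `x₁,
x₂` inside it, a suitable `v` exists unless `y - x₁` and `y - x₂` are antiparallel, so that `y` is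
on the segment from `x₁` to `x₂`. Null convexity forbids that segment to be null, so then both
kernels are smooth near `y`. A partition of unity glues the cases. Derivatives in `x` produce
integrals of the same type, so the limit is smooth (`KernelFamily.contDiffOn_limit`).

Fubini at `ε > 0` and dominated convergence identify the limit as the kernel of `∫ ψ H_F(y, f₁)
H_F(y, f₂) dy` (`exists_smooth_kernel`). The derivative in `Θ` is moved onto `f₂` and then onto this
kernel. The domain `B₂ \ B₁` can be replaced by all of spacetime, because `dχ` vanishes almost
everywhere off it. -/

theorem eventually_continuous_of_compact_support [T2Space X] [TopologicalSpace P] {K : Set X}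
    (hK : IsCompact K) {S : P → X → V} {p₀ : P} (h0 : ∀ p, ∀ y ∉ K, S p y = 0)
    (hS : ∀ y ∈ K, ∀ᶠ q in 𝓝 (p₀, y), ContinuousAt (Function.uncurry S) q) :
    ∀ᶠ p in 𝓝 p₀, Continuous (S p) := by
  filter_upwards [hK.eventually_forall_of_forall_eventually
    (P := fun p y => ContinuousAt (Function.uncurry S) (p, y)) hS] with p hp
  rw [continuous_iff_continuousAt]
  intro y
  by_cases hy : y ∈ K
  · exact (hp y hy).comp (f := fun y => (p, y)) (by fun_prop)
  · have : S p =ᶠ[𝓝 y] fun _ => 0 := by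
      filter_upwards [hK.isClosed.isOpen_compl.mem_nhds hy] with z hz using h0 p z hz
    exact continuousAt_const.congr this.symm

theorem eventually_norm_le_of_compact_support [TopologicalSpace P] {K : Set X}
    (hK : IsCompact K) {S : P → X → V} {p₀ : P} (h0 : ∀ p, ∀ y ∉ K, S p y = 0)
    (hS : ∀ y ∈ K, ContinuousAt (Function.uncurry S) (p₀, y)) :
    ∃ C, 0 ≤ C ∧ ∀ᶠ p in 𝓝 p₀, ∀ y, ‖S p y‖ ≤ C := by
  have hc : ContinuousOn (S p₀) K := fun y hy =>
    ((hS y hy).comp (f := fun y => (p₀, y)) (by fun_prop)).continuousWithinAt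
  obtain ⟨C, hC⟩ := hK.exists_bound_of_continuousOn hc
  refine ⟨|C| + 1, by positivity, ?_⟩
  filter_upwards [hK.eventually_forall_of_forall_eventually
    (P := fun p y => ‖S p y‖ ≤ |C| + 1) (x₀ := p₀) fun y hy => by
      have h1 : ‖S p₀ y‖ < |C| + 1 := by linarith [hC y hy, le_abs_self C]
      exact ((hS y hy).norm.eventually (gt_mem_nhds h1)).mono fun q hq => hq.le] with p hp y
  by_cases hy : y ∈ K
  · exact hp y hy
  · rw [h0 p y hy, norm_zero]; positivity

variable [T2Space X] [MeasurableSpace X] [BorelSpace X]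

/-- Dominated convergence: compactness of `K` makes the bound uniform for parameters near `p₀`.
Continuity is assumed near `(p₀, y)`, not only there, so that nearby integrands are measurable. -/
theorem continuousAt_integral_of_compact_support [NormedSpace ℝ V] [TopologicalSpace P]
    [FirstCountableTopology P] {μ : Measure X} [IsFiniteMeasureOnCompacts μ]
    [SecondCountableTopologyEither X V] {K : Set X}
    (hK : IsCompact K) {S : P → X → V} {p₀ : P} (h0 : ∀ p, ∀ y ∉ K, S p y = 0)
    (hS : ∀ y ∈ K, ∀ᶠ q in 𝓝 (p₀, y), ContinuousAt (Function.uncurry S) q) :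
    ContinuousAt (fun p => ∫ y, S p y ∂μ) p₀ := by
  have hS' := fun y hy => (hS y hy).self_of_nhds
  obtain ⟨C, -, hC⟩ := eventually_norm_le_of_compact_support hK h0 hS'
  refine tendsto_integral_filter_of_dominated_convergence (K.indicator fun _ => C) ?_ ?_ ?_ ?_
  · filter_upwards [eventually_continuous_of_compact_support hK h0 hS] with p hp
    exact hp.aestronglyMeasurable
  · filter_upwards [hC] with p hp
    refine Eventually.of_forall fun y => ?_
    by_cases hy : y ∈ K
    · simpa [hy] using hp y
    · simp [hy, h0 p y hy]
  · exact (integrable_indicator_iff hK.measurableSet).2 (integrableOn_const hK.measure_lt_top.ne)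
  · refine Eventually.of_forall fun y => ?_
    by_cases hy : y ∈ K
    · exact (hS' y hy).tendsto.comp
        ((Continuous.prodMk_left y).tendsto p₀)
    · simp only [h0 _ y hy]; exact tendsto_const_nhds

theorem integrable_of_compact_support {μ : Measure X} [IsFiniteMeasureOnCompacts μ]
    {K : Set X} (hK : IsCompact K) {S : X → V} (h0 : ∀ y ∉ K, S y = 0) (hS : Continuous S) :
    Integrable S μ :=
  hS.integrable_of_hasCompactSupport (HasCompactSupport.intro hK h0)

end ParametricIntegral

/-! ### Derivatives and total derivatives under the integral sign. -/

section ParametricDeriv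

variable {P X : Type*} [NormedAddCommGroup P] [NormedSpace ℝ P]
  [NormedAddCommGroup X] [NormedSpace ℝ X] [FiniteDimensional ℝ X] [MeasurableSpace X]
  [BorelSpace X]

/-- Differentiation under the integral sign, for an integrand supported in a compact set. -/
theorem exists_hasFDerivAt_integral_of_compact_support {μ : Measure X}
    [IsFiniteMeasureOnCompacts μ] {K : Set X} (hK : IsCompact K) {S : P → X → ℂ} {p₀ : P}
    (h0 : ∀ p, ∀ y ∉ K, S p y = 0)
    (hS : ∀ y ∈ K, ContDiffAt ℝ ∞ (Function.uncurry S) (p₀, y)) :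
    ∃ L : P →L[ℝ] ℂ, HasFDerivAt (fun p => ∫ y, S p y ∂μ) L p₀ ∧
      ∀ e, L e = ∫ y, fderiv ℝ (Function.uncurry S) (p₀, y) (e, 0) ∂μ := by
  classical
  let S' : P → X → P →L[ℝ] ℂ := fun p y =>
    (fderiv ℝ (Function.uncurry S) (p, y)).comp (ContinuousLinearMap.inl ℝ P X)
  have hev : ∀ y ∈ K, ∀ᶠ q in 𝓝 (p₀, y), ContDiffAt ℝ 1 (Function.uncurry S) q := fun y hy =>
    ((hS y hy).of_le (by norm_cast)).eventually (by simp)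
  have h0z : ∀ p, ∀ y ∉ K, Function.uncurry S =ᶠ[𝓝 (p, y)] fun _ => 0 := by
    intro p y hy
    have := (continuous_snd.tendsto (p, y)).eventually (hK.isClosed.isOpen_compl.mem_nhds hy)
    filter_upwards [this] with q hq using h0 _ _ hq
  have h0' : ∀ p, ∀ y ∉ K, S' p y = 0 := by
    intro p y hy
    simp only [S', (h0z p y hy).fderiv_eq]
    simp
  have hSc : ∀ y ∈ K, ∀ᶠ q in 𝓝 (p₀, y), ContinuousAt (Function.uncurry S) q := fun y hy =>
    (hev y hy).mono fun q hq => hq.continuousAt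
  have hSc' : ∀ y ∈ K, ∀ᶠ q in 𝓝 (p₀, y), ContinuousAt (Function.uncurry S') q := by
    intro y hy
    filter_upwards [hev y hy] with q hq
    have : ContinuousAt (fderiv ℝ (Function.uncurry S)) q :=
      (hq.fderiv_right (m := 0) (by norm_num)).continuousAt
    exact (((ContinuousLinearMap.compL ℝ P (P × X) ℂ).flip
      (ContinuousLinearMap.inl ℝ P X)).continuous.continuousAt).comp this
  have hdiff : ∀ᶠ p in 𝓝 p₀, ∀ y, HasFDerivAt (S · y) (S' p y) p := by
    filter_upwards [hK.eventually_forall_of_forall_eventually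
      (P := fun p y => ContDiffAt ℝ 1 (Function.uncurry S) (p, y)) hev] with p hp y
    have hd : DifferentiableAt ℝ (Function.uncurry S) (p, y) := by
      by_cases hy : y ∈ K
      · exact (hp y hy).differentiableAt (by simp)
      · exact (differentiableAt_const _).congr_of_eventuallyEq (h0z p y hy)
    exact hd.hasFDerivAt.comp p (f := fun p => (p, y)) (hasFDerivAt_prodMk_left p y)
  obtain ⟨C, hC0, hC⟩ := eventually_norm_le_of_compact_support hK h0'
    (fun y hy => (hSc' y hy).self_of_nhds)
  have hcont := eventually_continuous_of_compact_support hK h0 hSc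
  have hcont' := (eventually_continuous_of_compact_support hK h0' hSc').self_of_nhds
  have hint' : Integrable (S' p₀) μ := integrable_of_compact_support hK (h0' p₀) hcont'
  obtain ⟨s, hs, hsP⟩ := (hC.and hdiff).exists_mem
  refine ⟨_, hasFDerivAt_integral_of_dominated_of_fderiv_le (F' := S')
    (bound := K.indicator fun _ => C) hs (hcont.mono fun p hp => hp.aestronglyMeasurable)
    (integrable_of_compact_support hK (h0 p₀) hcont.self_of_nhds) hcont'.aestronglyMeasurable
    ?_ ?_ ?_, ?_⟩
  · refine Eventually.of_forall fun y p hp => ?_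
    by_cases hy : y ∈ K
    · simpa [hy] using (hsP p hp).1 y
    · simp [hy, h0' p y hy]
  · exact (integrable_indicator_iff hK.measurableSet).2 (integrableOn_const hK.measure_lt_top.ne)
  · exact Eventually.of_forall fun y p hp => (hsP p hp).2 y
  · intro e
    rw [ContinuousLinearMap.integral_apply hint']
    rfl

/-- Integration by parts against the constant function `1`. -/
theorem integral_fderiv_apply_eq_zero {μ : Measure X} [μ.IsAddHaarMeasure] {K : Set X}
    (hK : IsCompact K) {S : X → ℂ} (h0 : ∀ y ∉ K, S y = 0) (hS : ContDiff ℝ 1 S) (v : X) :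
    ∫ y, fderiv ℝ S y v ∂μ = 0 := by
  have hc : HasCompactSupport S := HasCompactSupport.intro hK h0
  have hi : Integrable (fun y => fderiv ℝ S y v) μ :=
    ((hS.continuous_fderiv (by simp)).clm_apply continuous_const).integrable_of_hasCompactSupport
      (hc.fderiv_apply ℝ v)
  have := integral_bilinear_hasLineDerivAt_right_eq_neg_left_of_integrable (μ := μ)
    (f := fun _ : X => (1 : ℝ)) (f' := fun _ => 0) (g := S) (g' := fun y => fderiv ℝ S y v)
    (v := v) (B := ContinuousLinearMap.lsmul ℝ ℝ) (by simp) (by simpa using hi)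
    (by simpa using hS.continuous.integrable_of_hasCompactSupport hc)
    (fun x _ => by simpa using (hasFDerivAt_const (1:ℝ) x).hasLineDerivAt v)
    (fun x _ => (hS.differentiable (by simp) x).hasFDerivAt.hasLineDerivAt v)
  simpa using this

end ParametricDeriv

/-! ### Boundary values of holomorphic functions of moderate growth -/

/-- The open set `{Im z > 0} ∪ {Re z ≠ 0}`, which contains the punctured closed upper half
plane. -/
def slitUpper : Set ℂ := {z | 0 < z.im ∨ z.re ≠ 0}

theorem isOpen_slitUpper : IsOpen slitUpper :=
  (isOpen_lt continuous_const Complex.continuous_im).union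
    (isOpen_ne_fun Complex.continuous_re continuous_const)

theorem mem_slitUpper_of_im_pos {z : ℂ} (h : 0 < z.im) : z ∈ slitUpper := Or.inl h

/-- Holomorphic functions on a neighbourhood of the punctured closed upper half plane, which grow
at most polynomially in `1 / Im z` as `z` approaches the real axis. -/
structure HasModerateGrowth (F : ℂ → ℂ) : Prop where
  differentiableOn : DifferentiableOn ℂ F slitUpper
  bound : ∀ R : ℝ, ∃ (C : ℝ) (N : ℕ), 0 ≤ C ∧
    ∀ z : ℂ, 0 < z.im → ‖z‖ ≤ R → ‖F z‖ ≤ C / z.im ^ N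

namespace HasModerateGrowth

theorem contDiffAt {F : ℂ → ℂ} (hF : HasModerateGrowth F) {z : ℂ} (hz : z ∈ slitUpper) :
    ContDiffAt ℝ ∞ F z :=
  ((hF.differentiableOn.contDiffOn isOpen_slitUpper (n := ∞)).contDiffAt
    (isOpen_slitUpper.mem_nhds hz)).restrict_scalars ℝ

theorem hasDerivAt {F : ℂ → ℂ} (hF : HasModerateGrowth F) {z : ℂ} (hz : z ∈ slitUpper) :
    HasDerivAt F (deriv F z) z :=
  (hF.differentiableOn.differentiableAt (isOpen_slitUpper.mem_nhds hz)).hasDerivAt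

/-- Cauchy's estimate on the disc of radius `Im z / 2`, which stays in the upper half plane, costs
one power of `1 / Im z`. The disc lies in `‖w‖ ≤ 2R`, hence the bound for `F` is taken at `2 * R`.
-/
theorem deriv {F : ℂ → ℂ} (hF : HasModerateGrowth F) : HasModerateGrowth (deriv F) where
  differentiableOn := hF.differentiableOn.deriv isOpen_slitUpper
  bound R := by
    obtain ⟨C, N, hC0, hC⟩ := hF.bound (2 * R)
    refine ⟨C * 2 ^ (N + 1), N + 1, by positivity, fun z hz hzR => ?_⟩
    have him : ∀ w ∈ Metric.closedBall z (z.im / 2), z.im / 2 ≤ w.im := by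
      intro w hw
      have h1 : |(w - z).im| ≤ z.im / 2 :=
        (Complex.abs_im_le_norm _).trans (by simpa [dist_eq_norm] using hw)
      rw [Complex.sub_im] at h1
      linarith [(abs_le.1 h1).1]
    have hd : DiffContOnCl ℂ F (Metric.ball z (z.im / 2)) := by
      refine DifferentiableOn.diffContOnCl (hF.differentiableOn.mono fun w hw => ?_)
      have := him w (Metric.closure_ball_subset_closedBall hw)
      exact mem_slitUpper_of_im_pos (by linarith)
    have hb : ∀ w ∈ Metric.sphere z (z.im / 2), ‖F w‖ ≤ C / (z.im / 2) ^ N := by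
      intro w hw
      have h1 := him w (Metric.sphere_subset_closedBall hw)
      have h2 : ‖w‖ ≤ 2 * R := by
        have h3 : ‖w - z‖ = z.im / 2 := by simpa [dist_eq_norm] using hw
        have h4 : z.im ≤ R := ((le_abs_self _).trans (Complex.abs_im_le_norm z)).trans hzR
        have h5 : ‖w‖ ≤ ‖w - z‖ + ‖z‖ := by simpa using norm_add_le (w - z) z
        linarith
      refine (hC w (by linarith) h2).trans ?_
      gcongr
    refine (Complex.norm_deriv_le_of_forall_mem_sphere_norm_le (by positivity) hd hb).trans ?_
    rw [div_pow, pow_succ, pow_succ]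
    apply le_of_eq
    field_simp

theorem one : HasModerateGrowth fun _ => 1 where
  differentiableOn := differentiableOn_const 1
  bound _ := ⟨1, 0, zero_le_one, fun z _ _ => by simp⟩

end HasModerateGrowth

/-- The branch of the logarithm that is holomorphic off the negative imaginary axis. -/
def upperLog (z : ℂ) : ℂ := Complex.log (-Complex.I * z) + (Real.pi / 2 : ℝ) * Complex.I

theorem differentiableOn_upperLog : DifferentiableOn ℂ upperLog slitUpper := by
  refine DifferentiableOn.add_const _ (DifferentiableOn.clog (by fun_prop) fun z hz => ?_)
  rw [Complex.mem_slitPlane_iff]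
  rcases hz with h | h
  · exact Or.inl (by simpa using h)
  · exact Or.inr (by simpa using h)

/-- At `ε > 0` only the upper half plane matters, so the principal branch may be exchanged for one
that remains smooth across the negative real axis, where `σ < 0` in the limit. -/
theorem upperLog_eq_log {z : ℂ} (hz : 0 < z.im) : upperLog z = Complex.log z := by
  have h0 : z ≠ 0 := fun h => by simp [h] at hz
  have h1 : Complex.log (-Complex.I * z) = Complex.log (-Complex.I) + Complex.log z := by
    refine Complex.log_mul (by simp) h0 ?_
    rw [Complex.arg_neg_I]
    have h2 := Complex.arg_nonneg_iff.2 hz.le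
    have h3 := Complex.arg_le_pi z
    constructor <;> linarith [Real.pi_pos]
  rw [upperLog, h1, Complex.log_neg_I]
  push_cast
  ring

theorem norm_exp_upperLog_mul {z : ℂ} (hz : 0 < z.im) (c : ℝ) :
    ‖Complex.exp (-(c : ℂ) * upperLog z)‖ = ‖z‖ ^ (-c) := by
  have h0 : 0 < ‖z‖ := norm_pos_iff.2 fun h => by simp [h] at hz
  rw [upperLog_eq_log hz, Complex.norm_exp, ← Complex.ofReal_neg, Complex.re_ofReal_mul,
    Complex.log_re, Real.rpow_def_of_pos h0, mul_comm]

theorem hasModerateGrowth_exp_upperLog {c : ℝ} (hc : 0 ≤ c) :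
    HasModerateGrowth fun z => Complex.exp (-(c : ℂ) * upperLog z) where
  differentiableOn := (differentiableOn_upperLog.const_mul _).cexp
  bound R := by
    obtain ⟨N, hN⟩ := exists_nat_ge c
    refine ⟨max 1 (R ^ N), N, le_max_of_le_left zero_le_one, fun z hz hzR => ?_⟩
    have h0 : 0 < ‖z‖ := norm_pos_iff.2 fun h => by simp [h] at hz
    have him : z.im ≤ ‖z‖ := (le_abs_self _).trans (Complex.abs_im_le_norm z)
    rw [norm_exp_upperLog_mul hz, le_div_iff₀ (by positivity)]
    calc ‖z‖ ^ (-c) * z.im ^ N ≤ ‖z‖ ^ (-c) * ‖z‖ ^ N := by gcongr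
      _ = ‖z‖ ^ ((N : ℝ) - c) := by
        rw [← Real.rpow_natCast, ← Real.rpow_add h0]; ring_nf
      _ ≤ max 1 (R ^ N) := by
        rcases le_total ‖z‖ 1 with h | h
        · exact le_max_of_le_left (Real.rpow_le_one h0.le h (by linarith))
        · refine le_max_of_le_right ?_
          calc ‖z‖ ^ ((N : ℝ) - c) ≤ ‖z‖ ^ (N : ℝ) :=
                Real.rpow_le_rpow_of_exponent_le h (by linarith)
            _ = ‖z‖ ^ N := Real.rpow_natCast _ _
            _ ≤ R ^ N := by gcongr

theorem hasModerateGrowth_upperLog_sub (a : ℂ) : HasModerateGrowth fun z => upperLog z - a where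
  differentiableOn := differentiableOn_upperLog.sub_const a
  bound R := by
    refine ⟨|R| * (|R| + Real.pi + ‖a‖) + 1, 1, by positivity, fun z hz hzR => ?_⟩
    have h0 : 0 < ‖z‖ := norm_pos_iff.2 fun h => by simp [h] at hz
    have him : z.im ≤ ‖z‖ := (le_abs_self _).trans (Complex.abs_im_le_norm z)
    have hR : ‖z‖ ≤ |R| := hzR.trans (le_abs_self R)
    have hlog : ‖Complex.log z‖ ≤ |Real.log ‖z‖| + Real.pi := by
      refine (Complex.norm_le_abs_re_add_abs_im _).trans ?_
      rw [Complex.log_re, Complex.log_im]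
      gcongr
      exact Complex.abs_arg_le_pi z
    -- Both sides follow from `log t ≤ t - 1`, applied to `‖z‖` and to its inverse.
    have hl : |Real.log ‖z‖| ≤ |R| + 1 / z.im := by
      rw [abs_le]
      constructor
      · have h1 := Real.log_le_sub_one_of_pos (inv_pos.2 h0)
        rw [Real.log_inv] at h1
        have h2 : ‖z‖⁻¹ ≤ 1 / z.im := by rw [one_div]; gcongr
        linarith [abs_nonneg R]
      · have h1 := Real.log_le_sub_one_of_pos h0
        have h2 : 0 < 1 / z.im := by positivity
        linarith
    rw [upperLog_eq_log hz, pow_one]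
    refine (norm_sub_le _ _).trans ?_
    rw [add_div]
    have h3 : |R| + Real.pi + ‖a‖ ≤ |R| * (|R| + Real.pi + ‖a‖) / z.im := by
      rw [le_div_iff₀ hz, mul_comm]
      have : 0 ≤ |R| + Real.pi + ‖a‖ := by positivity
      gcongr
      exact him.trans hR
    linarith

/-! ### The complexified squared distance -/

section Geometry

variable {d : ℕ}

/-- The Minkowski bilinear form `η_{μν} v^μ w^ν`. -/
def polar (v w : Spacetime d) : ℝ := ∑ μ, eta μ * v μ * w μ

theorem eta_mul_self {d : ℕ} (μ : Fin (d + 1)) : eta μ * eta μ = 1 := by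
  unfold eta; split_ifs <;> norm_num

@[fun_prop]
theorem contDiff_sigma {n : WithTop ℕ∞} : ContDiff ℝ n (sigma (d := d)) := by
  unfold sigma
  refine ContDiff.sum fun μ _ => contDiff_const.mul (ContDiff.pow ?_ 2)
  exact (EuclideanSpace.proj (𝕜 := ℝ) μ).contDiff

@[fun_prop]
theorem contDiff_polar {n : WithTop ℕ∞} (v : Spacetime d) : ContDiff ℝ n (polar v) := by
  unfold polar
  refine ContDiff.sum fun μ _ => contDiff_const.mul ?_
  exact (EuclideanSpace.proj (𝕜 := ℝ) μ).contDiff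

theorem polar_smul_right (v : Spacetime d) (c : ℝ) (w : Spacetime d) :
    polar v (c • w) = c * polar v w := by
  simp only [polar, Finset.mul_sum, PiLp.smul_apply, smul_eq_mul]
  exact Finset.sum_congr rfl fun μ _ => by ring

theorem polar_add_right (v w w' : Spacetime d) :
    polar v (w + w') = polar v w + polar v w' := by
  simp only [polar, ← Finset.sum_add_distrib, PiLp.add_apply]
  exact Finset.sum_congr rfl fun μ _ => by ring

theorem polar_self (v : Spacetime d) : polar v v = sigma v :=
  Finset.sum_congr rfl fun μ _ => by ring

theorem sigma_smul (c : ℝ) (w : Spacetime d) : sigma (c • w) = c ^ 2 * sigma w := by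
  simp only [sigma, Finset.mul_sum, PiLp.smul_apply, smul_eq_mul]
  exact Finset.sum_congr rfl fun μ _ => by ring

theorem sigma_neg (w : Spacetime d) : sigma (-w) = sigma w := by
  simp [sigma]

theorem sigma_add_smul (w v : Spacetime d) (s : ℝ) :
    sigma (w + s • v) = sigma w + 2 * s * polar v w + s ^ 2 * sigma v := by
  simp only [sigma, polar, Finset.mul_sum, ← Finset.sum_add_distrib, PiLp.add_apply,
    PiLp.smul_apply, smul_eq_mul]
  exact Finset.sum_congr rfl fun μ _ => by ring

/-- The value `σ(w + iτv) + iε` of the complexified squared distance. -/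
def phase (v w : Spacetime d) (τ ε : ℝ) : ℂ :=
  ((sigma w - τ ^ 2 * sigma v : ℝ) : ℂ) + Complex.I * ((2 * τ * polar v w + ε : ℝ) : ℂ)

theorem phase_im (v w : Spacetime d) (τ ε : ℝ) : (phase v w τ ε).im = 2 * τ * polar v w + ε := by
  simp only [phase, Complex.add_im, Complex.ofReal_im, Complex.I_mul_im, Complex.ofReal_re,
    zero_add]

theorem phase_zero (v w : Spacetime d) (ε : ℝ) :
    phase v w 0 ε = (sigma w : ℂ) + Complex.I * ε := by
  simp [phase]

theorem phase_zero_re (v w : Spacetime d) (ε : ℝ) : (phase v w 0 ε).re = sigma w := by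
  simp [phase]

/-- The real shift `s` and the imaginary shift `τ` enter only through `s + iτ`, and polynomially;
this is the holomorphy behind `fderiv_damped`. -/
theorem phase_add_smul (v w : Spacetime d) (τ s ε : ℝ) :
    phase v (w + s • v) τ ε = (sigma w : ℂ) + 2 * (s + Complex.I * τ) * polar v w +
      (s + Complex.I * τ) ^ 2 * sigma v + Complex.I * ε := by
  simp only [phase, sigma_add_smul, polar_add_right, polar_smul_right, polar_self]
  push_cast
  linear_combination (-(τ : ℂ) ^ 2 * sigma v) * Complex.I_sq

section

variable {Z : Type*} [NormedAddCommGroup Z] [NormedSpace ℝ Z] {n : WithTop ℕ∞}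

theorem contDiff_phase (v : Spacetime d) {w : Z → Spacetime d} {τ ε : Z → ℝ}
    (hw : ContDiff ℝ n w) (hτ : ContDiff ℝ n τ) (hε : ContDiff ℝ n ε) :
    ContDiff ℝ n fun z => phase v (w z) (τ z) (ε z) := by
  unfold phase
  refine ContDiff.add (Complex.ofRealCLM.contDiff.comp ?_)
    (contDiff_const.mul (Complex.ofRealCLM.contDiff.comp ?_))
  · exact (contDiff_sigma.comp hw).sub ((hτ.pow 2).mul contDiff_const)
  · exact ((contDiff_const.mul hτ).mul ((contDiff_polar v).comp hw)).add hε

end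

/-- The product of two regularized kernels at `y - x₁` and `y - x₂`, continued to imaginary
translations `y + iτv`. -/
def damped (F₁ F₂ : ℂ → ℂ) (v : Spacetime d) (τ ε : ℝ) (y : Spacetime d)
    (x : Spacetime d × Spacetime d) : ℂ :=
  F₁ (phase v (y - x.1) τ ε) * F₂ (phase v (y - x.2) τ ε)

theorem contDiffAt_damped {Z : Type*} [NormedAddCommGroup Z] [NormedSpace ℝ Z] {F₁ F₂ : ℂ → ℂ}
    (h₁ : HasModerateGrowth F₁) (h₂ : HasModerateGrowth F₂) (v : Spacetime d) {τ ε : Z → ℝ}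
    {y : Z → Spacetime d} {x : Z → Spacetime d × Spacetime d} (hτ : ContDiff ℝ ∞ τ)
    (hε : ContDiff ℝ ∞ ε) (hy : ContDiff ℝ ∞ y) (hx : ContDiff ℝ ∞ x) {z : Z}
    (hz₁ : phase v (y z - (x z).1) (τ z) (ε z) ∈ slitUpper)
    (hz₂ : phase v (y z - (x z).2) (τ z) (ε z) ∈ slitUpper) :
    ContDiffAt ℝ ∞ (fun z => damped F₁ F₂ v (τ z) (ε z) (y z) (x z)) z := by
  have p₁ : ContDiff ℝ ∞ fun z => phase v (y z - (x z).1) (τ z) (ε z) :=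
    contDiff_phase v (hy.sub hx.fst) hτ hε
  have p₂ : ContDiff ℝ ∞ fun z => phase v (y z - (x z).2) (τ z) (ε z) :=
    contDiff_phase v (hy.sub hx.snd) hτ hε
  have e₁ := ContDiffAt.comp z (h₁.contDiffAt hz₁) p₁.contDiffAt
  have e₂ := ContDiffAt.comp z (h₂.contDiffAt hz₂) p₂.contDiffAt
  exact e₁.mul e₂

/-- Cauchy-Riemann equation in the complex translation parameter `s + iτ` along `v`. -/
theorem fderiv_damped {F₁ F₂ : ℂ → ℂ} (h₁ : HasModerateGrowth F₁) (h₂ : HasModerateGrowth F₂)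
    (v : Spacetime d) {τ ε : ℝ} {y : Spacetime d} {x : Spacetime d × Spacetime d}
    (hz₁ : phase v (y - x.1) τ ε ∈ slitUpper) (hz₂ : phase v (y - x.2) τ ε ∈ slitUpper) :
    fderiv ℝ (fun q : ℝ × Spacetime d => damped F₁ F₂ v q.1 ε q.2 x) (τ, y) (1, 0) =
      Complex.I *
        fderiv ℝ (fun q : ℝ × Spacetime d => damped F₁ F₂ v q.1 ε q.2 x) (τ, y) (0, v) := by
  set G := fun q : ℝ × Spacetime d => damped F₁ F₂ v q.1 ε q.2 x with hG
  have hGd : DifferentiableAt ℝ G (τ, y) :=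
    (contDiffAt_damped (Z := ℝ × Spacetime d) (τ := Prod.fst) (ε := fun _ => ε) (y := Prod.snd)
      (x := fun _ => x) (z := (τ, y)) h₁ h₂ v contDiff_fst contDiff_const contDiff_snd contDiff_const
      hz₁ hz₂).differentiableAt (by simp)
  let P : Spacetime d → ℂ → ℂ := fun w κ =>
    (sigma w : ℂ) + 2 * κ * polar v w + κ ^ 2 * sigma v + Complex.I * ε
  have hP : ∀ w (s t : ℝ), phase v (w + s • v) t ε = P w (s + Complex.I * t) := fun w s t =>
    phase_add_smul v w t s ε
  have hP0 : ∀ w (t : ℝ), phase v w t ε = P w (Complex.I * t) := fun w t => by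
    simpa using hP w 0 t
  have hPd : ∀ w κ, DifferentiableAt ℂ (P w) κ := fun w κ => by fun_prop
  obtain ⟨h, hH⟩ : ∃ h, HasDerivAt (fun κ => F₁ (P (y - x.1) κ) * F₂ (P (y - x.2) κ)) h
      (Complex.I * τ) := by
    refine ⟨_, ((DifferentiableAt.comp _ ?_ (hPd _ _)).mul
      (DifferentiableAt.comp _ ?_ (hPd _ _))).hasDerivAt⟩
    · rw [← hP0]; exact (h₁.hasDerivAt hz₁).differentiableAt
    · rw [← hP0]; exact (h₂.hasDerivAt hz₂).differentiableAt
  have e1 : HasDerivAt (fun s : ℝ => G ((τ, y) + s • ((1 : ℝ), (0 : Spacetime d))))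
      (h * Complex.I) 0 := by
    have hl : HasDerivAt (fun s : ℝ => Complex.I * ((τ + s : ℝ) : ℂ)) Complex.I 0 := by
      simpa using (((hasDerivAt_id (0 : ℝ)).const_add τ).ofReal_comp).const_mul Complex.I
    have := HasDerivAt.comp (0 : ℝ) (by simpa using hH) hl
    refine this.congr_of_eventuallyEq (Eventually.of_forall fun s => ?_)
    simp [hG, damped, hP0]
  have e2 : HasDerivAt (fun s : ℝ => G ((τ, y) + s • ((0 : ℝ), v))) h 0 := by
    have hl : HasDerivAt (fun s : ℝ => (s : ℂ) + Complex.I * τ) 1 0 := by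
      simpa using ((hasDerivAt_id (0 : ℝ)).ofReal_comp).add_const (Complex.I * τ)
    have := HasDerivAt.comp (0 : ℝ) (by simpa using hH) hl
    rw [mul_one] at this
    refine this.congr_of_eventuallyEq (Eventually.of_forall fun s => ?_)
    simp only [hG, damped, Prod.smul_mk, smul_zero, Prod.mk_add_mk, add_zero, Function.comp,
      add_sub_right_comm y, hP]
  rw [← (hGd.hasFDerivAt.hasLineDerivAt (1, 0)).lineDeriv,
    ← (hGd.hasFDerivAt.hasLineDerivAt (0, v)).lineDeriv, lineDeriv, lineDeriv, e1.deriv, e2.deriv,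
    mul_comm]

/-- Smooth amplitudes `A(y, x)` that vanish for `y` outside `K`. -/
structure IsAmplitude (K : Set (Spacetime d))
    (A : Spacetime d → Spacetime d × Spacetime d → ℂ) : Prop where
  contDiff : ContDiff ℝ ∞ (Function.uncurry A)
  zero : ∀ y ∉ K, ∀ x, A y x = 0

namespace IsAmplitude

variable {K : Set (Spacetime d)} {A : Spacetime d → Spacetime d × Spacetime d → ℂ}

theorem fderiv (hK : IsClosed K) (hA : IsAmplitude K A)
    (e : Spacetime d × (Spacetime d × Spacetime d)) :
    IsAmplitude K fun y x => fderiv ℝ (Function.uncurry A) (y, x) e where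
  contDiff := by
    have := (hA.contDiff.fderiv_right (m := ∞) (by simp)).clm_apply (contDiff_const (c := e))
    exact this
  zero y hy x := by
    have : Function.uncurry A =ᶠ[𝓝 (y, x)] fun _ => 0 := by
      have := (continuous_fst.tendsto (y, x)).eventually (hK.isOpen_compl.mem_nhds hy)
      filter_upwards [this] with q hq using hA.zero _ hq _
    rw [this.fderiv_eq]
    simp

theorem smul (hA : IsAmplitude K A) {b : Spacetime d × (Spacetime d × Spacetime d) → ℂ}
    (hb : ContDiff ℝ ∞ b) : IsAmplitude K fun y x => b (y, x) * A y x where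
  contDiff := hb.mul hA.contDiff
  zero y hy x := by simp [hA.zero y hy x]

theorem contDiff_comp {Z : Type*} [NormedAddCommGroup Z] [NormedSpace ℝ Z]
    (hA : IsAmplitude K A) {y : Z → Spacetime d} {x : Z → Spacetime d × Spacetime d}
    (hy : ContDiff ℝ ∞ y) (hx : ContDiff ℝ ∞ x) : ContDiff ℝ ∞ fun z => A (y z) (x z) :=
  hA.contDiff.comp (hy.prodMk hx)

end IsAmplitude

/-- The oscillatory integral of an amplitude against a product of two kernels, shifted by `iτv`. -/
def shiftedIntegral (A : Spacetime d → Spacetime d × Spacetime d → ℂ) (F₁ F₂ : ℂ → ℂ)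
    (v : Spacetime d) (τ ε : ℝ) (x : Spacetime d × Spacetime d) : ℂ :=
  ∫ y, A y x * damped F₁ F₂ v τ ε y x

/-- The `τ`-derivative of the kernel is `i` times its derivative along `v`, which integration by
parts in `y` throws onto the amplitude. Regularity of the kernels is needed only over the support
`K`. -/
theorem hasDerivAt_shiftedIntegral {K : Set (Spacetime d)} (hK : IsCompact K)
    {A : Spacetime d → Spacetime d × Spacetime d → ℂ} (hA : IsAmplitude K A) {F₁ F₂ : ℂ → ℂ}
    (h₁ : HasModerateGrowth F₁) (h₂ : HasModerateGrowth F₂) (v : Spacetime d) {τ ε : ℝ}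
    {x : Spacetime d × Spacetime d} (hz₁ : ∀ y ∈ K, phase v (y - x.1) τ ε ∈ slitUpper)
    (hz₂ : ∀ y ∈ K, phase v (y - x.2) τ ε ∈ slitUpper) :
    HasDerivAt (fun τ => shiftedIntegral A F₁ F₂ v τ ε x)
      (-Complex.I * shiftedIntegral
        (fun y x => fderiv ℝ (Function.uncurry A) (y, x) (v, 0)) F₁ F₂ v τ ε x) τ := by
  set G := fun q : ℝ × Spacetime d => damped F₁ F₂ v q.1 ε q.2 x with hG
  set a : Spacetime d → ℂ := fun y => A y x with ha
  have hac : ContDiff ℝ ∞ a := hA.contDiff_comp contDiff_id contDiff_const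
  have hGs : ∀ y ∈ K, ContDiffAt ℝ ∞ G (τ, y) := fun y hy =>
    contDiffAt_damped (Z := ℝ × Spacetime d) (τ := Prod.fst) (ε := fun _ => ε) (y := Prod.snd)
      (x := fun _ => x) (z := (τ, y)) h₁ h₂ v contDiff_fst contDiff_const contDiff_snd contDiff_const
      (hz₁ y hy) (hz₂ y hy)
  have hSs : ∀ y ∈ K, ContDiffAt ℝ ∞ (Function.uncurry fun τ y => a y * G (τ, y)) (τ, y) :=
    fun y hy => (hac.comp contDiff_snd).contDiffAt.mul (hGs y hy)
  obtain ⟨L, hL, hL1⟩ := exists_hasFDerivAt_integral_of_compact_support (μ := volume) hK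
    (S := fun τ y => a y * G (τ, y)) (p₀ := τ) (fun τ y hy => by simp [ha, hA.zero y hy x]) hSs
  have hT0 : ∀ y ∉ K, a y * G (τ, y) = 0 := fun y hy => by simp [ha, hA.zero y hy x]
  have hTs : ContDiff ℝ 1 fun y => a y * G (τ, y) := by
    rw [contDiff_iff_contDiffAt]
    intro y
    by_cases hy : y ∈ K
    · exact ((hSs y hy).comp y (f := fun y => (τ, y)) (by fun_prop)).of_le (by norm_cast)
    · refine (contDiffAt_const (c := (0 : ℂ))).congr_of_eventuallyEq ?_
      filter_upwards [hK.isClosed.isOpen_compl.mem_nhds hy] with z hz using hT0 z hz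
  -- The `τ`-derivative is a total derivative along `v`, which integrates to zero, minus the term
  -- where the amplitude is differentiated.
  have key : ∀ y, fderiv ℝ (Function.uncurry fun τ y => a y * G (τ, y)) (τ, y) (1, 0) =
      Complex.I * fderiv ℝ (fun y => a y * G (τ, y)) y v -
        Complex.I * (fderiv ℝ (Function.uncurry A) (y, x) (v, 0) * G (τ, y)) := by
    intro y
    by_cases hy : y ∈ K
    · have hGd := ((hGs y hy).differentiableAt (by simp)).hasFDerivAt
      have had : HasFDerivAt a (fderiv ℝ a y) y := (hac.differentiable (by simp) y).hasFDerivAt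
      have e1 := ((had.comp (τ, y) (f := Prod.snd)
        (hasFDerivAt_snd (𝕜 := ℝ) (p := (τ, y)))).mul hGd).fderiv
      have hGy := hGd.comp y (f := fun y => (τ, y)) (hasFDerivAt_prodMk_right τ y)
      have e2 := (had.mul hGy).fderiv
      have e3 : fderiv ℝ a y = (fderiv ℝ (Function.uncurry A) (y, x)).comp
          (ContinuousLinearMap.inl ℝ _ _) :=
        ((hA.contDiff.differentiable (by simp) (y, x)).hasFDerivAt.comp y (f := fun y => (y, x))
          (hasFDerivAt_prodMk_left y x)).fderiv
      have e4 := fderiv_damped h₁ h₂ v (hz₁ y hy) (hz₂ y hy)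
      have e5 : fderiv ℝ (Function.uncurry fun τ y => a y * G (τ, y)) (τ, y) (1, 0) =
          a y * fderiv ℝ G (τ, y) (1, 0) := by
        have : (Function.uncurry fun τ y => a y * G (τ, y)) =
          ((a ∘ Prod.snd) * G : ℝ × Spacetime d → ℂ) := rfl
        rw [this, e1]
        simp
      have e6 : fderiv ℝ (fun y => a y * G (τ, y)) y v =
          a y * fderiv ℝ G (τ, y) (0, v) + G (τ, y) * fderiv ℝ (Function.uncurry A) (y, x) (v, 0)
          := by
        have : (fun y => a y * G (τ, y)) = (a * (G ∘ fun y => (τ, y)) : Spacetime d → ℂ) := rfl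
        rw [this, e2, e3]
        simp
      rw [e5, e6, e4]
      ring
    · have h0 : (Function.uncurry fun τ y => a y * G (τ, y)) =ᶠ[𝓝 (τ, y)] fun _ => 0 := by
        have := (continuous_snd.tendsto (τ, y)).eventually (hK.isClosed.isOpen_compl.mem_nhds hy)
        filter_upwards [this] with q hq
        simp [ha, Function.uncurry, hA.zero _ hq x]
      have h0' : (fun y => a y * G (τ, y)) =ᶠ[𝓝 y] fun _ => 0 := by
        filter_upwards [hK.isClosed.isOpen_compl.mem_nhds hy] with z hz using hT0 z hz
      rw [h0.fderiv_eq, h0'.fderiv_eq, (hA.fderiv hK.isClosed (v, 0)).zero y hy x]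
      simp
  have hI1 : Integrable fun y => fderiv ℝ (fun y => a y * G (τ, y)) y v :=
    ((hTs.continuous_fderiv (by simp)).clm_apply continuous_const).integrable_of_hasCompactSupport
      ((HasCompactSupport.intro hK hT0).fderiv_apply ℝ v)
  have hI2 : Integrable fun y => fderiv ℝ (Function.uncurry A) (y, x) (v, 0) * G (τ, y) := by
    have hA' := hA.fderiv hK.isClosed (v, 0)
    refine integrable_of_compact_support hK (fun y hy => by simp [hA'.zero y hy x]) ?_
    rw [continuous_iff_continuousAt]
    intro y
    by_cases hy : y ∈ K
    · exact (hA'.contDiff_comp contDiff_id contDiff_const).continuous.continuousAt.mul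
        ((hGs y hy).continuousAt.comp (f := fun y => (τ, y)) (by fun_prop))
    · refine (continuousAt_const (y := (0 : ℂ))).congr ?_
      filter_upwards [hK.isClosed.isOpen_compl.mem_nhds hy] with z hz
      simp [hA'.zero z hz x]
  have hval : L 1 = -Complex.I * shiftedIntegral
        (fun y x => fderiv ℝ (Function.uncurry A) (y, x) (v, 0)) F₁ F₂ v τ ε x := by
    rw [hL1]
    simp_rw [key]
    rw [integral_sub (hI1.const_mul _) (hI2.const_mul _), integral_const_mul, integral_const_mul,
      integral_fderiv_apply_eq_zero hK hT0 hTs]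
    simp [shiftedIntegral, hG]
  rw [← hval]
  exact hL.hasDerivAt

end Geometry

/-! ### Limits of oscillatory integrals -/

section Oscillatory

variable {d : ℕ}

/-- The family `g ε` converges as `ε → 0⁺`, uniformly near `p` up to oscillation. -/
def ConvergesAt {Z V : Type*} [TopologicalSpace Z] [TopologicalSpace V] (g : ℝ → Z → V) (p : Z) :
    Prop :=
  ∃ L, Tendsto (Function.uncurry g) (𝓝[>] (0 : ℝ) ×ˢ 𝓝 p) (𝓝 L)

theorem eventually_pos_and {Z : Type*} [TopologicalSpace Z] {p : Z} {P : Z → Prop}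
    (h : ∀ᶠ x in 𝓝 p, P x) :
    ∀ᶠ q : ℝ × Z in 𝓝[>] (0 : ℝ) ×ˢ 𝓝 p, (0 < q.1 ∧ q.1 < 1) ∧ P q.2 :=
  Eventually.prod_mk (Ioo_mem_nhdsGT zero_lt_one : ∀ᶠ ε in 𝓝[>] (0 : ℝ), 0 < ε ∧ ε < 1) h

theorem nhdsGT_prod_le {Z : Type*} [TopologicalSpace Z] (p : Z) :
    𝓝[>] (0 : ℝ) ×ˢ 𝓝 p ≤ 𝓝 ((0 : ℝ), p) := by
  rw [nhds_prod_eq]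
  exact Filter.prod_mono nhdsWithin_le_nhds le_rfl

theorem continuousAt_shiftedIntegral {K : Set (Spacetime d)} (hK : IsCompact K)
    {A : Spacetime d → Spacetime d × Spacetime d → ℂ} (hA : IsAmplitude K A) {F₁ F₂ : ℂ → ℂ}
    (h₁ : HasModerateGrowth F₁) (h₂ : HasModerateGrowth F₂) (v : Spacetime d) {τ ε : ℝ}
    {x : Spacetime d × Spacetime d} (hz₁ : ∀ y ∈ K, phase v (y - x.1) τ ε ∈ slitUpper)
    (hz₂ : ∀ y ∈ K, phase v (y - x.2) τ ε ∈ slitUpper) :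
    ContinuousAt (Function.uncurry (shiftedIntegral A F₁ F₂ v τ)) (ε, x) := by
  have hAs : ContDiff ℝ ∞ fun z : (ℝ × (Spacetime d × Spacetime d)) × Spacetime d =>
      A z.2 z.1.2 := hA.contDiff_comp contDiff_snd contDiff_fst.snd
  have hc : ContinuousAt (fun q : ℝ × (Spacetime d × Spacetime d) =>
      ∫ y, A y q.2 * damped F₁ F₂ v τ q.1 y q.2) (ε, x) := by
    refine continuousAt_integral_of_compact_support (μ := volume) hK
      (S := fun (q : ℝ × (Spacetime d × Spacetime d)) y => A y q.2 * damped F₁ F₂ v τ q.1 y q.2)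
      (fun q y hy => by simp [hA.zero y hy]) fun y hy => ?_
    have hd : ContDiffAt ℝ ∞ (fun z : (ℝ × (Spacetime d × Spacetime d)) × Spacetime d =>
        damped F₁ F₂ v τ z.1.1 z.2 z.1.2) ((ε, x), y) :=
      contDiffAt_damped (Z := (ℝ × (Spacetime d × Spacetime d)) × Spacetime d)
        (τ := fun _ => τ) (ε := fun z => z.1.1) (y := fun z => z.2) (x := fun z => z.1.2)
        (z := ((ε, x), y)) h₁ h₂ v contDiff_const contDiff_fst.fst contDiff_snd contDiff_fst.snd
        (hz₁ y hy) (hz₂ y hy)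
    have h1 := (hAs.contDiffAt.mul hd).of_le (m := 1) (by norm_cast)
    exact (h1.eventually (by simp)).mono fun q hq => hq.continuousAt
  exact hc

theorem convergesAt_shiftedIntegral {K : Set (Spacetime d)} (hK : IsCompact K)
    {A : Spacetime d → Spacetime d × Spacetime d → ℂ} (hA : IsAmplitude K A) {F₁ F₂ : ℂ → ℂ}
    (h₁ : HasModerateGrowth F₁) (h₂ : HasModerateGrowth F₂) (v : Spacetime d) {τ : ℝ}
    {x : Spacetime d × Spacetime d} (hz₁ : ∀ y ∈ K, phase v (y - x.1) τ 0 ∈ slitUpper)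
    (hz₂ : ∀ y ∈ K, phase v (y - x.2) τ 0 ∈ slitUpper) :
    ConvergesAt (shiftedIntegral A F₁ F₂ v τ) x := by
  refine ⟨_, (continuousAt_shiftedIntegral hK hA h₁ h₂ v hz₁ hz₂).tendsto.mono_left
    (nhdsGT_prod_le x)⟩

theorem exists_polar_ge {K : Set (Spacetime d)} (hK : IsCompact K) {v : Spacetime d}
    {p : Spacetime d × Spacetime d}
    (hv : ∀ y ∈ K, 0 < polar v (y - p.1) ∧ 0 < polar v (y - p.2)) :
    ∃ c > 0, ∀ᶠ x in 𝓝 p, ∀ y ∈ K, c ≤ polar v (y - x.1) ∧ c ≤ polar v (y - x.2) := by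
  have hc : Continuous fun q : (Spacetime d × Spacetime d) × Spacetime d =>
      min (polar v (q.2 - q.1.1)) (polar v (q.2 - q.1.2)) := by
    have := (contDiff_polar (n := 0) v).continuous
    fun_prop
  obtain ⟨c, hc0, hcK⟩ := hK.exists_forall_le' (a := 0)
    (f := fun y => min (polar v (y - p.1)) (polar v (y - p.2)))
    (hc.comp (Continuous.prodMk_right p)).continuousOn (fun y hy => lt_min (hv y hy).1 (hv y hy).2)
  refine ⟨c / 2, by positivity, hK.eventually_forall_of_forall_eventually fun y hy => ?_⟩
  have h1 : c / 2 < min (polar v (y - p.1)) (polar v (y - p.2)) := by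
    linarith [hcK y hy]
  filter_upwards [hc.continuousAt.eventually (lt_mem_nhds h1)] with q hq
  exact le_min_iff.1 hq.le

/-- Over `K` the phases have imaginary part at least `2cτ`, uniformly in `ε > 0`, so moderate growth
applies. The order of quantifiers matters: `N` is fixed before `A`, since the descent in `τ`
differentiates the amplitude repeatedly. -/
theorem exists_norm_shiftedIntegral_le {K : Set (Spacetime d)} (hK : IsCompact K) {F₁ F₂ : ℂ → ℂ}
    (h₁ : HasModerateGrowth F₁) (h₂ : HasModerateGrowth F₂) {v : Spacetime d}
    {p : Spacetime d × Spacetime d}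
    (hv : ∀ y ∈ K, 0 < polar v (y - p.1) ∧ 0 < polar v (y - p.2)) :
    ∃ N : ℕ, ∀ A, IsAmplitude K A → ∃ D : ℝ, 0 ≤ D ∧
      ∀ᶠ q : ℝ × (Spacetime d × Spacetime d) in 𝓝[>] (0 : ℝ) ×ˢ 𝓝 p, ∀ τ ∈ Ioc (0 : ℝ) 1,
        ‖shiftedIntegral A F₁ F₂ v τ q.1 q.2‖ ≤ D / τ ^ N := by
  obtain ⟨c, hc0, hc⟩ := exists_polar_ge hK hv
  have hph : ContDiff ℝ 0 fun z : ℝ × ℝ × Spacetime d => phase v z.2.2 z.1 z.2.1 :=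
    contDiff_phase v contDiff_snd.snd contDiff_fst contDiff_snd.fst
  have hcomp : IsCompact (K ×ˢ Metric.closedBall p 1 ×ˢ Icc (0 : ℝ) 1 ×ˢ Icc (0 : ℝ) 1) :=
    hK.prod ((isCompact_closedBall p 1).prod (isCompact_Icc.prod isCompact_Icc))
  obtain ⟨R₁, hR₁⟩ := hcomp.exists_bound_of_continuousOn
    (f := fun z => phase v (z.1 - z.2.1.1) z.2.2.1 z.2.2.2)
    (hph.continuous.comp (g := fun z : ℝ × ℝ × Spacetime d => phase v z.2.2 z.1 z.2.1)
      (f := fun z : Spacetime d × (Spacetime d × Spacetime d) × ℝ × ℝ =>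
        (z.2.2.1, z.2.2.2, z.1 - z.2.1.1)) (by fun_prop)).continuousOn
  obtain ⟨R₂, hR₂⟩ := hcomp.exists_bound_of_continuousOn
    (f := fun z => phase v (z.1 - z.2.1.2) z.2.2.1 z.2.2.2)
    (hph.continuous.comp (g := fun z : ℝ × ℝ × Spacetime d => phase v z.2.2 z.1 z.2.1)
      (f := fun z : Spacetime d × (Spacetime d × Spacetime d) × ℝ × ℝ =>
        (z.2.2.1, z.2.2.2, z.1 - z.2.1.2)) (by fun_prop)).continuousOn
  obtain ⟨C₁, N₁, hC₁0, hC₁⟩ := h₁.bound R₁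
  obtain ⟨C₂, N₂, hC₂0, hC₂⟩ := h₂.bound R₂
  refine ⟨N₁ + N₂, fun A hA => ?_⟩
  obtain ⟨a, ha⟩ := (hK.prod (isCompact_closedBall p 1)).exists_bound_of_continuousOn
    hA.contDiff.continuous.continuousOn
  refine ⟨|a| * (C₁ / (2 * c) ^ N₁ * (C₂ / (2 * c) ^ N₂)) * volume.real K, by positivity, ?_⟩
  filter_upwards [eventually_pos_and (hc.and (Metric.closedBall_mem_nhds p one_pos))]
    with ⟨ε, x⟩ ⟨⟨hε0, hε1⟩, hcx, hx⟩ τ hτ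
  simp only at hε0 hε1 hcx hx
  have hzero : ∀ y ∉ K, A y x * damped F₁ F₂ v τ ε y x = 0 := fun y hy => by
    simp [hA.zero y hy x]
  rw [shiftedIntegral, ← setIntegral_eq_integral_of_forall_compl_eq_zero hzero]
  have hτ0 : 0 < τ := hτ.1
  have hF : ∀ (F : ℂ → ℂ) (C : ℝ) (N : ℕ) (R : ℝ) (w : Spacetime d), 0 ≤ C →
      (∀ z : ℂ, 0 < z.im → ‖z‖ ≤ R → ‖F z‖ ≤ C / z.im ^ N) → c ≤ polar v w →
      ‖phase v w τ ε‖ ≤ R → ‖F (phase v w τ ε)‖ ≤ C / (2 * c) ^ N / τ ^ N := by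
    intro F C N R w hC hFC hw hR
    have h2 : 2 * c * τ ≤ (phase v w τ ε).im := by rw [phase_im]; nlinarith
    have h3 : 0 < 2 * c * τ := by positivity
    refine (hFC _ (h3.trans_le h2) hR).trans ?_
    rw [div_div, ← mul_pow]
    gcongr
  have hb : ∀ y ∈ K, ‖A y x * damped F₁ F₂ v τ ε y x‖ ≤
      |a| * (C₁ / (2 * c) ^ N₁ * (C₂ / (2 * c) ^ N₂)) / τ ^ (N₁ + N₂) := by
    intro y hy
    have hm : (y, x, τ, ε) ∈ K ×ˢ Metric.closedBall p 1 ×ˢ Icc (0 : ℝ) 1 ×ˢ Icc (0 : ℝ) 1 :=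
      ⟨hy, hx, ⟨hτ.1.le, hτ.2⟩, ⟨hε0.le, hε1.le⟩⟩
    have e1 := hF F₁ C₁ N₁ R₁ (y - x.1) hC₁0 hC₁ (hcx y hy).1 (hR₁ (y, x, τ, ε) hm)
    have e2 := hF F₂ C₂ N₂ R₂ (y - x.2) hC₂0 hC₂ (hcx y hy).2 (hR₂ (y, x, τ, ε) hm)
    have e3 : ‖A y x‖ ≤ |a| := (ha (y, x) ⟨hy, hx⟩).trans (le_abs_self a)
    rw [damped, norm_mul, norm_mul]
    calc _ ≤ |a| * (C₁ / (2 * c) ^ N₁ / τ ^ N₁ * (C₂ / (2 * c) ^ N₂ / τ ^ N₂)) := by gcongr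
      _ = _ := by rw [pow_add]; field_simp
  refine (norm_setIntegral_le_of_norm_le_const hK.measure_lt_top hb).trans (le_of_eq ?_)
  ring

/-! ### Removing the imaginary shift. -/

section Shift

variable {K : Set (Spacetime d)} {F₁ F₂ : ℂ → ℂ} {v : Spacetime d} {p : Spacetime d × Spacetime d}

theorem eventually_hasDerivAt_shiftedIntegral (hK : IsCompact K)
    (h₁ : HasModerateGrowth F₁) (h₂ : HasModerateGrowth F₂)
    (hv : ∀ y ∈ K, 0 < polar v (y - p.1) ∧ 0 < polar v (y - p.2)) :
    ∀ᶠ q : ℝ × (Spacetime d × Spacetime d) in 𝓝[>] (0 : ℝ) ×ˢ 𝓝 p, ∀ A, IsAmplitude K A →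
      ∀ τ : ℝ, 0 ≤ τ → HasDerivAt (fun τ => shiftedIntegral A F₁ F₂ v τ q.1 q.2)
        (-Complex.I * shiftedIntegral
          (fun y x => fderiv ℝ (Function.uncurry A) (y, x) (v, 0)) F₁ F₂ v τ q.1 q.2) τ := by
  obtain ⟨c, hc0, hc⟩ := exists_polar_ge hK hv
  filter_upwards [eventually_pos_and hc] with ⟨ε, x⟩ ⟨⟨hε0, _⟩, hcx⟩ A hA τ hτ
  refine hasDerivAt_shiftedIntegral hK hA h₁ h₂ v (fun y hy => ?_) fun y hy => ?_ <;>
  · refine mem_slitUpper_of_im_pos ?_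
    have h3 := hcx y hy
    rw [phase_im]
    simp only at hε0
    have := mul_nonneg hτ (hc0.le.trans h3.1)
    have := mul_nonneg hτ (hc0.le.trans h3.2)
    linarith

/-- Integration by parts in the shift parameter. -/
theorem eventually_moment_eq (hK : IsCompact K)
    (h₁ : HasModerateGrowth F₁) (h₂ : HasModerateGrowth F₂)
    (hv : ∀ y ∈ K, 0 < polar v (y - p.1) ∧ 0 < polar v (y - p.2)) :
    ∀ᶠ q : ℝ × (Spacetime d × Spacetime d) in 𝓝[>] (0 : ℝ) ×ˢ 𝓝 p, ∀ A, IsAmplitude K A →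
      ContinuousOn (fun τ : ℝ => shiftedIntegral A F₁ F₂ v τ q.1 q.2) (Icc 0 1) ∧ ∀ m : ℕ,
      shiftedIntegral A F₁ F₂ v 1 q.1 q.2 - 0 ^ m * shiftedIntegral A F₁ F₂ v 0 q.1 q.2 =
        m * (∫ τ in (0 : ℝ)..1, (τ : ℂ) ^ (m - 1) * shiftedIntegral A F₁ F₂ v τ q.1 q.2) -
        Complex.I * ∫ τ in (0 : ℝ)..1, (τ : ℂ) ^ m * shiftedIntegral
          (fun y x => fderiv ℝ (Function.uncurry A) (y, x) (v, 0)) F₁ F₂ v τ q.1 q.2 := by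
  filter_upwards [eventually_hasDerivAt_shiftedIntegral hK h₁ h₂ hv] with q hq A hA
  have hcont : ∀ A, IsAmplitude K A →
      ContinuousOn (fun τ : ℝ => shiftedIntegral A F₁ F₂ v τ q.1 q.2) (Icc 0 1) :=
    fun A hA τ hτ => (hq A hA τ hτ.1).continuousAt.continuousWithinAt
  refine ⟨hcont A hA, fun m => ?_⟩
  have hA' := hA.fderiv hK.isClosed (v, 0)
  have hi : ∀ A, IsAmplitude K A → ∀ k : ℕ, IntervalIntegrable
      (fun τ : ℝ => (τ : ℂ) ^ k * shiftedIntegral A F₁ F₂ v τ q.1 q.2) volume 0 1 := by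
    intro A hA k
    refine ContinuousOn.intervalIntegrable ?_
    rw [uIcc_of_le zero_le_one]
    exact (by fun_prop : Continuous fun τ : ℝ => (τ : ℂ) ^ k).continuousOn.mul (hcont A hA)
  -- For `m = 0` the truncated exponent `m - 1` is harmless because its coefficient `m` vanishes.
  -- The boundary value at `τ = 0` carries `0 ^ m`, so it survives exactly when `m = 0`.
  have hd : ∀ τ ∈ uIcc (0 : ℝ) 1,
      HasDerivAt (fun τ : ℝ => (τ : ℂ) ^ m * shiftedIntegral A F₁ F₂ v τ q.1 q.2)
      (m * ((τ : ℂ) ^ (m - 1) * shiftedIntegral A F₁ F₂ v τ q.1 q.2) -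
        Complex.I * ((τ : ℂ) ^ m * shiftedIntegral
          (fun y x => fderiv ℝ (Function.uncurry A) (y, x) (v, 0)) F₁ F₂ v τ q.1 q.2)) τ := by
    intro τ hτ
    rw [uIcc_of_le zero_le_one] at hτ
    have hpow : HasDerivAt (fun τ : ℝ => (τ : ℂ) ^ m) (m * (τ : ℂ) ^ (m - 1)) τ := by
      simpa using (hasDerivAt_pow m (τ : ℂ)).comp_ofReal
    refine (hpow.mul (hq A hA τ hτ.1)).congr_deriv ?_
    ring
  have := intervalIntegral.integral_eq_sub_of_hasDerivAt hd
    (((hi A hA (m - 1)).const_mul _).sub ((hi _ hA' m).const_mul _))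
  rw [intervalIntegral.integral_sub ((hi A hA (m - 1)).const_mul _) ((hi _ hA' m).const_mul _),
    intervalIntegral.integral_const_mul, intervalIntegral.integral_const_mul] at this
  rw [this]
  simp

/-- The weight `τ ^ k` absorbs the blow-up `D / τ ^ N`, leaving the constant `D` as dominating
function. -/
theorem convergesAt_moment_of_ge (hK : IsCompact K)
    (h₁ : HasModerateGrowth F₁) (h₂ : HasModerateGrowth F₂)
    (hv : ∀ y ∈ K, 0 < polar v (y - p.1) ∧ 0 < polar v (y - p.2)) :
    ∃ N : ℕ, ∀ k ≥ N, ∀ A, IsAmplitude K A →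
      ConvergesAt (fun ε x => ∫ τ in (0 : ℝ)..1,
        (τ : ℂ) ^ k * shiftedIntegral A F₁ F₂ v τ ε x) p := by
  obtain ⟨N, hN⟩ := exists_norm_shiftedIntegral_le hK h₁ h₂ hv
  refine ⟨N, fun k hk A hA => ?_⟩
  obtain ⟨D, hD0, hD⟩ := hN A hA
  refine ⟨∫ τ in (0 : ℝ)..1, (τ : ℂ) ^ k * shiftedIntegral A F₁ F₂ v τ 0 p, ?_⟩
  refine intervalIntegral.tendsto_integral_filter_of_dominated_convergence (fun _ => D) ?_ ?_
    (by simp) ?_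
  · filter_upwards [eventually_moment_eq hK h₁ h₂ hv] with q hq
    rw [uIoc_of_le zero_le_one]
    refine ContinuousOn.aestronglyMeasurable ?_ measurableSet_Ioc
    exact (by fun_prop : Continuous fun τ : ℝ => (τ : ℂ) ^ k).continuousOn.mul
      ((hq A hA).1.mono Ioc_subset_Icc_self)
  · filter_upwards [hD] with q hq
    refine Eventually.of_forall fun τ hτ => ?_
    rw [uIoc_of_le zero_le_one] at hτ
    have hτ0 : 0 < τ := hτ.1
    rw [norm_mul, norm_pow, Complex.norm_real, Real.norm_of_nonneg hτ0.le]
    calc τ ^ k * ‖shiftedIntegral A F₁ F₂ v τ q.1 q.2‖ ≤ τ ^ N * (D / τ ^ N) :=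
          mul_le_mul (pow_le_pow_of_le_one hτ0.le hτ.2 hk) (hq τ hτ) (norm_nonneg _)
            (by positivity)
      _ = D := by field_simp
  · refine Eventually.of_forall fun τ hτ => ?_
    rw [uIoc_of_le zero_le_one] at hτ
    have hz : ∀ y ∈ K, phase v (y - p.1) τ 0 ∈ slitUpper ∧ phase v (y - p.2) τ 0 ∈ slitUpper := by
      intro y hy
      constructor <;> refine mem_slitUpper_of_im_pos ?_ <;> rw [phase_im]
      · have := mul_pos hτ.1 (hv y hy).1; linarith
      · have := mul_pos hτ.1 (hv y hy).2; linarith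
    refine Tendsto.const_mul _ ?_
    refine (continuousAt_shiftedIntegral hK hA h₁ h₂ v (fun y hy => (hz y hy).1)
      fun y hy => (hz y hy).2).tendsto.mono_left
      (nhdsGT_prod_le p)

/-- Descent in `k`: by parts, `(k + 1) ∫ τ^k I(A) = I(A)(1) + i ∫ τ^(k+1) I(∂_v A)`. The value at `τ
= 1` converges because the phases there have positive imaginary part even at `ε = 0`. -/
theorem convergesAt_moment (hK : IsCompact K)
    (h₁ : HasModerateGrowth F₁) (h₂ : HasModerateGrowth F₂)
    (hv : ∀ y ∈ K, 0 < polar v (y - p.1) ∧ 0 < polar v (y - p.2)) (k : ℕ)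
    {A : Spacetime d → Spacetime d × Spacetime d → ℂ} (hA : IsAmplitude K A) :
    ConvergesAt (fun ε x => ∫ τ in (0 : ℝ)..1,
      (τ : ℂ) ^ k * shiftedIntegral A F₁ F₂ v τ ε x) p := by
  obtain ⟨N, hN⟩ := convergesAt_moment_of_ge hK h₁ h₂ hv
  obtain ⟨j, hj⟩ : ∃ j, N ≤ k + j := ⟨N, by omega⟩
  induction j generalizing k A with
  | zero => exact hN k hj A hA
  | succ j ih =>
    obtain ⟨L, hL⟩ := ih (k + 1) (hA.fderiv hK.isClosed (v, 0)) (by omega)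
    have hz : ∀ y ∈ K, phase v (y - p.1) 1 0 ∈ slitUpper ∧ phase v (y - p.2) 1 0 ∈ slitUpper := by
      intro y hy
      constructor <;> refine mem_slitUpper_of_im_pos ?_ <;> rw [phase_im]
      · linarith [(hv y hy).1]
      · linarith [(hv y hy).2]
    obtain ⟨L', hL'⟩ := convergesAt_shiftedIntegral hK hA h₁ h₂ v (fun y hy => (hz y hy).1)
      fun y hy => (hz y hy).2
    refine ⟨_, Tendsto.congr' ?_ ((hL'.add (hL.const_mul Complex.I)).const_mul
      ((k + 1 : ℂ)⁻¹))⟩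
    filter_upwards [eventually_moment_eq hK h₁ h₂ hv] with q hq
    have h3 := (hq A hA).2 (k + 1)
    have h4 : (k + 1 : ℂ) ≠ 0 := by exact_mod_cast Nat.succ_ne_zero k
    simp only [Nat.cast_add, Nat.cast_one, add_tsub_cancel_right, ne_eq, Nat.add_eq_zero_iff,
      one_ne_zero, and_false, not_false_eq_true, zero_pow, zero_mul, sub_zero] at h3
    simp only [Function.uncurry]
    rw [h3, inv_mul_eq_iff_eq_mul₀ h4]
    ring

/-- The case `m = 0` of the moment identity expresses the unshifted integral as `I(A)(1) + i ∫ I(∂_v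
A)`. -/
theorem convergesAt_of_polar_pos (hK : IsCompact K)
    (h₁ : HasModerateGrowth F₁) (h₂ : HasModerateGrowth F₂)
    (hv : ∀ y ∈ K, 0 < polar v (y - p.1) ∧ 0 < polar v (y - p.2))
    {A : Spacetime d → Spacetime d × Spacetime d → ℂ} (hA : IsAmplitude K A) :
    ConvergesAt (shiftedIntegral A F₁ F₂ v 0) p := by
  obtain ⟨L, hL⟩ := convergesAt_moment hK h₁ h₂ hv 0 (hA.fderiv hK.isClosed (v, 0))
  have hz : ∀ y ∈ K, phase v (y - p.1) 1 0 ∈ slitUpper ∧ phase v (y - p.2) 1 0 ∈ slitUpper := by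
    intro y hy
    constructor <;> refine mem_slitUpper_of_im_pos ?_ <;> rw [phase_im]
    · linarith [(hv y hy).1]
    · linarith [(hv y hy).2]
  obtain ⟨L', hL'⟩ := convergesAt_shiftedIntegral hK hA h₁ h₂ v (fun y hy => (hz y hy).1)
    fun y hy => (hz y hy).2
  refine ⟨_, Tendsto.congr' ?_ (hL'.add (hL.const_mul Complex.I))⟩
  filter_upwards [eventually_moment_eq hK h₁ h₂ hv] with q hq
  have h3 := (hq A hA).2 0
  simp only [Nat.cast_zero, zero_mul, pow_zero, one_mul, zero_sub] at h3
  simp only [Function.uncurry, pow_zero, one_mul]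
  linear_combination h3

end Shift

end Oscillatory

/-! ### Smoothness of locally uniform limits -/

section Limits

variable {E : Type*} [TopologicalSpace E]

/-- Joint convergence in `(ε, x)` keeps `g ε x` in a given closed neighbourhood of `g₀ p`; letting
`ε → 0⁺` at fixed `x` keeps `g₀ x` there. -/
theorem continuousOn_of_tendsto_nhdsGT {V : Type*} [TopologicalSpace V] [RegularSpace V]
    {g : ℝ → E → V} {g₀ : E → V} {O : Set E}
    (hg : ∀ p ∈ O, Tendsto (Function.uncurry g) (𝓝[>] (0 : ℝ) ×ˢ 𝓝 p) (𝓝 (g₀ p))) :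
    ContinuousOn g₀ O := by
  intro p hp
  refine (closed_nhds_basis (g₀ p)).tendsto_right_iff.2 fun W hW => ?_
  have h1 : ∀ᶠ x in 𝓝 p, ∀ᶠ ε in 𝓝[>] (0 : ℝ), g ε x ∈ W :=
    (eventually_swap_iff.1 ((hg p hp).eventually hW.1)).curry
  filter_upwards [nhdsWithin_le_nhds h1, self_mem_nhdsWithin] with x hx hxO
  refine hW.2.mem_of_tendsto ((hg x hxO).comp (f := fun ε => (ε, x)) ?_) hx
  exact tendsto_id.prodMk (tendsto_const_nhds.mono_right le_rfl)

theorem tendsto_of_tendsto_prod {V : Type*} [TopologicalSpace V] {g : ℝ → E → V} {p : E} {L : V}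
    (hg : Tendsto (Function.uncurry g) (𝓝[>] (0 : ℝ) ×ˢ 𝓝 p) (𝓝 L)) :
    Tendsto (fun ε => g ε p) (𝓝[>] 0) (𝓝 L) :=
  hg.comp (tendsto_id.prodMk tendsto_const_nhds)

theorem tendstoUniformlyOnFilter_of_tendsto_prod {V : Type*} [UniformSpace V]
    {g : ℝ → E → V} {g₀ : E → V} {p : E}
    (hg : Tendsto (Function.uncurry g) (𝓝[>] (0 : ℝ) ×ˢ 𝓝 p) (𝓝 (g₀ p)))
    (hc : ContinuousAt g₀ p) : TendstoUniformlyOnFilter g g₀ (𝓝[>] 0) (𝓝 p) := by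
  rw [tendstoUniformlyOnFilter_iff_tendsto]
  exact ((hc.tendsto.comp tendsto_snd).prodMk_nhds hg).mono_right (nhds_le_uniformity (g₀ p))

theorem ConvergesAt.add {V : Type*} [TopologicalSpace V] [Add V] [ContinuousAdd V]
    {g h : ℝ → E → V} {p : E} (hg : ConvergesAt g p) (hh : ConvergesAt h p) :
    ConvergesAt (fun ε x => g ε x + h ε x) p := by
  obtain ⟨L, hL⟩ := hg
  obtain ⟨L', hL'⟩ := hh
  exact ⟨_, hL.add hL'⟩

theorem ConvergesAt.congr {V : Type*} [TopologicalSpace V]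
    {g h : ℝ → E → V} {p : E} (hg : ConvergesAt g p) (hgh : ∀ ε > 0, ∀ x, g ε x = h ε x) :
    ConvergesAt h p := by
  obtain ⟨L, hL⟩ := hg
  refine ⟨L, hL.congr' ?_⟩
  filter_upwards [eventually_pos_and (Eventually.of_forall fun _ : E => True.intro)] with q hq
  exact hgh _ hq.1.1 _

end Limits

/-- Joint convergence to a continuous limit is locally uniform convergence, so limit and derivative
commute. Writing the differential through finitely many scalar families `h i` lets each be treated
as an integral of the original type. -/
theorem hasFDerivAt_of_tendsto_nhdsGT {E ι : Type*} [NormedAddCommGroup E] [NormedSpace ℝ E]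
    [Fintype ι] (c : ι → E →L[ℝ] ℝ) {g : ℝ → E → ℂ} {g₀ : E → ℂ} {h : ι → ℝ → E → ℂ}
    {h₀ : ι → E → ℂ} {O : Set E} (hO : IsOpen O)
    (hg : ∀ p ∈ O, Tendsto (Function.uncurry g) (𝓝[>] (0 : ℝ) ×ˢ 𝓝 p) (𝓝 (g₀ p)))
    (hh : ∀ i, ∀ p ∈ O, Tendsto (Function.uncurry (h i)) (𝓝[>] (0 : ℝ) ×ˢ 𝓝 p) (𝓝 (h₀ i p)))
    (hd : ∀ ε > 0, ∀ p, HasFDerivAt (g ε) (∑ i, (c i).smulRight (h i ε p)) p) :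
    ∀ p ∈ O, HasFDerivAt g₀ (∑ i, (c i).smulRight (h₀ i p)) p := by
  intro p hp
  have hD : ∀ p ∈ O, Tendsto (Function.uncurry fun ε p => ∑ i, (c i).smulRight (h i ε p))
      (𝓝[>] (0 : ℝ) ×ˢ 𝓝 p) (𝓝 (∑ i, (c i).smulRight (h₀ i p))) := by
    intro p hp
    refine tendsto_finsetSum _ fun i _ => ?_
    exact ((ContinuousLinearMap.smulRightL ℝ E ℂ (c i)).continuous.tendsto _).comp (hh i p hp)
  refine hasFDerivAt_of_tendstoUniformlyOnFilter (l := 𝓝[>] (0 : ℝ)) (f := g)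
    (f' := fun ε p => ∑ i, (c i).smulRight (h i ε p))
    (g' := fun p => ∑ i, (c i).smulRight (h₀ i p))
    (tendstoUniformlyOnFilter_of_tendsto_prod (hD p hp)
      ((continuousOn_of_tendsto_nhdsGT hD).continuousAt (hO.mem_nhds hp))) ?_ ?_
  · filter_upwards [eventually_pos_and (Eventually.of_forall fun _ : E => True.intro)] with q hq
    exact hd _ hq.1.1 _
  · filter_upwards [hO.mem_nhds hp] with x hx using tendsto_of_tendsto_prod (hg x hx)

/-! ### Regular pairs, localization, and families closed under differentiation. -/

section Families

variable {d : ℕ}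

/-- Either some direction moves both `σ(y - p₁)` and `σ(y - p₂)` into the upper half plane, or
neither of them vanishes. -/
def IsRegularPair (y : Spacetime d) (p : Spacetime d × Spacetime d) : Prop :=
  (∃ v, 0 < polar v (y - p.1) ∧ 0 < polar v (y - p.2)) ∨
    (sigma (y - p.1) ≠ 0 ∧ sigma (y - p.2) ≠ 0)

theorem damped_zero (F₁ F₂ : ℂ → ℂ) (v : Spacetime d) (ε : ℝ) (y : Spacetime d)
    (x : Spacetime d × Spacetime d) : damped F₁ F₂ v 0 ε y x = damped F₁ F₂ 0 0 ε y x := by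
  simp only [damped, phase_zero]

theorem contDiff_damped_zero {F₁ F₂ : ℂ → ℂ} (h₁ : HasModerateGrowth F₁)
    (h₂ : HasModerateGrowth F₂) {ε : ℝ} (hε : 0 < ε) :
    ContDiff ℝ ∞ (Function.uncurry (damped F₁ F₂ (0 : Spacetime d) 0 ε)) := by
  rw [contDiff_iff_contDiffAt]
  intro z
  refine contDiffAt_damped (τ := fun _ => 0) (ε := fun _ => ε) (y := Prod.fst) (x := Prod.snd)
    (z := z) h₁ h₂ 0 contDiff_const contDiff_const contDiff_fst contDiff_snd
    (mem_slitUpper_of_im_pos ?_) (mem_slitUpper_of_im_pos ?_) <;>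
  · rw [phase_im]; simpa using hε

/-- Both alternatives of regularity are open in `y`, so each persists on a small closed ball, chosen
before the amplitude. -/
theorem exists_radius_convergesAt {F₁ F₂ : ℂ → ℂ} (h₁ : HasModerateGrowth F₁)
    (h₂ : HasModerateGrowth F₂) {y₀ : Spacetime d} {p : Spacetime d × Spacetime d}
    (hp : IsRegularPair y₀ p) :
    ∃ r > 0, ∀ A, IsAmplitude (Metric.closedBall y₀ r) A →
      ConvergesAt (shiftedIntegral A F₁ F₂ 0 0) p := by
  rcases hp with ⟨v, hv1, hv2⟩ | ⟨hs1, hs2⟩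
  · have hc := (contDiff_polar (n := 0) v).continuous
    have hev : ∀ᶠ y in 𝓝 y₀, 0 < polar v (y - p.1) ∧ 0 < polar v (y - p.2) :=
      ((show Continuous fun y => polar v (y - p.1) by fun_prop).continuousAt.eventually
        (lt_mem_nhds hv1)).and
      ((show Continuous fun y => polar v (y - p.2) by fun_prop).continuousAt.eventually
        (lt_mem_nhds hv2))
    obtain ⟨r, hr, hrs⟩ := Metric.nhds_basis_closedBall.eventually_iff.1 hev
    refine ⟨r, hr, fun A hA => ?_⟩
    have := convergesAt_of_polar_pos (isCompact_closedBall y₀ r) h₁ h₂ (p := p)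
      (fun y hy => hrs hy) hA
    exact this.congr fun ε _ x => by simp only [shiftedIntegral, damped_zero]
  · have hc := (contDiff_sigma (d := d) (n := 0)).continuous
    have hev : ∀ᶠ y in 𝓝 y₀, sigma (y - p.1) ≠ 0 ∧ sigma (y - p.2) ≠ 0 :=
      ((show Continuous fun y => sigma (y - p.1) by fun_prop).continuousAt.eventually_ne hs1).and
      ((show Continuous fun y => sigma (y - p.2) by fun_prop).continuousAt.eventually_ne hs2)
    obtain ⟨r, hr, hrs⟩ := Metric.nhds_basis_closedBall.eventually_iff.1 hev
    refine ⟨r, hr, fun A hA => ?_⟩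
    -- No shift is needed: at `ε = 0` the phases are real and nonzero, where the kernels are smooth.
    refine convergesAt_shiftedIntegral (isCompact_closedBall y₀ r) hA h₁ h₂ 0
      (fun y hy => Or.inr ?_) fun y hy => Or.inr ?_
    · rw [phase_zero_re]; exact (hrs hy).1
    · rw [phase_zero_re]; exact (hrs hy).2

theorem integrable_amplitude_mul_damped {K : Set (Spacetime d)} (hK : IsCompact K)
    {A : Spacetime d → Spacetime d × Spacetime d → ℂ} (hA : IsAmplitude K A) {F₁ F₂ : ℂ → ℂ}
    (h₁ : HasModerateGrowth F₁) (h₂ : HasModerateGrowth F₂) {ε : ℝ} (hε : 0 < ε)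
    (x : Spacetime d × Spacetime d) : Integrable fun y => A y x * damped F₁ F₂ 0 0 ε y x := by
  have h : Continuous fun y : Spacetime d => Function.uncurry A (y, x) *
      Function.uncurry (damped F₁ F₂ 0 0 ε) (y, x) :=
    (hA.contDiff.mul (contDiff_damped_zero h₁ h₂ hε)).continuous.comp (Continuous.prodMk_left x)
  exact integrable_of_compact_support hK (fun y hy => by simp [hA.zero y hy x]) h

/-- Reduction to amplitudes with small support, by a partition of unity. -/
theorem convergesAt_of_isRegularPair {K : Set (Spacetime d)} (hK : IsCompact K) {F₁ F₂ : ℂ → ℂ}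
    (h₁ : HasModerateGrowth F₁) (h₂ : HasModerateGrowth F₂) {p : Spacetime d × Spacetime d}
    (hp : ∀ y ∈ K, IsRegularPair y p) {A : Spacetime d → Spacetime d × Spacetime d → ℂ}
    (hA : IsAmplitude K A) : ConvergesAt (shiftedIntegral A F₁ F₂ 0 0) p := by
  classical
  choose! r hr0 hr using fun y hy => exists_radius_convergesAt h₁ h₂ (hp y hy)
  obtain ⟨t, htK, ht⟩ := hK.elim_nhds_subcover (fun y => Metric.ball y (r y / 2))
    fun y hy => Metric.ball_mem_nhds y (half_pos (hr0 y hy))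
  -- Induction on the number of balls: with `b` a bump equal to `1` on the half-radius ball at `i`,
  -- `b * A` lives in one good ball, and `(1 - b) * A` vanishes off the remaining half-radius balls.
  suffices H : ∀ s : Finset (Spacetime d), (∀ y ∈ s, y ∈ K) → ∀ A, IsAmplitude K A →
      (∀ y, y ∉ ⋃ i ∈ s, Metric.ball i (r i / 2) → ∀ x, A y x = 0) →
      ConvergesAt (shiftedIntegral A F₁ F₂ 0 0) p from
    H t htK A hA fun y hy x => hA.zero y (fun hyK => hy (ht hyK)) x
  intro s
  induction s using Finset.induction_on with
  | empty =>
    intro _ A _ h0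
    refine ⟨0, tendsto_const_nhds.congr fun q => ?_⟩
    simp [Function.uncurry, shiftedIntegral, h0]
  | insert i s _ ih =>
    intro hs A hA h0
    have hiK := hs i (Finset.mem_insert_self i s)
    let b : ContDiffBump i := ⟨r i / 2, r i, half_pos (hr0 i hiK), half_lt_self (hr0 i hiK)⟩
    have hb : ContDiff ℝ ∞ fun q : Spacetime d × (Spacetime d × Spacetime d) => (b q.1 : ℂ) :=
      Complex.ofRealCLM.contDiff.comp (b.contDiff.comp contDiff_fst)
    have hA1 := hA.smul hb
    have hA2 := hA.smul (contDiff_const (c := (1 : ℂ)) |>.sub hb)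
    have hc1 := hr i hiK _ ⟨hA1.contDiff, fun y hy x => by
      rw [b.zero_of_le_dist (by simpa using (lt_of_not_ge hy).le)]; simp⟩
    have hc2 := ih (fun y hy => hs y (Finset.mem_insert_of_mem hy)) _ hA2 fun y hy x => by
      by_cases hyi : y ∈ Metric.ball i (r i / 2)
      · rw [b.one_of_mem_closedBall (Metric.ball_subset_closedBall hyi)]; simp
      · rw [h0 y (by simpa [hyi] using hy) x, mul_zero]
    refine (hc1.add hc2).congr fun ε hε x => ?_
    simp only [shiftedIntegral]
    rw [← integral_add (integrable_amplitude_mul_damped hK hA1 h₁ h₂ hε x)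
      (integrable_amplitude_mul_damped hK hA2 h₁ h₂ hε x)]
    congr 1
    ext y
    ring

/-- Finite sums of smooth amplitudes times products of two regularized kernels. -/
inductive KernelFamily (K : Set (Spacetime d)) :
    (ℝ → Spacetime d → Spacetime d × Spacetime d → ℂ) → Prop
  | of {A : Spacetime d → Spacetime d × Spacetime d → ℂ} {F₁ F₂ : ℂ → ℂ} (hA : IsAmplitude K A)
      (h₁ : HasModerateGrowth F₁) (h₂ : HasModerateGrowth F₂) :
      KernelFamily K fun ε y x => A y x * damped F₁ F₂ 0 0 ε y x
  | add {S T : ℝ → Spacetime d → Spacetime d × Spacetime d → ℂ} (hS : KernelFamily K S)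
      (hT : KernelFamily K T) : KernelFamily K fun ε y x => S ε y x + T ε y x

namespace KernelFamily

variable {K : Set (Spacetime d)} {S : ℝ → Spacetime d → Spacetime d × Spacetime d → ℂ}

theorem zero_of_notMem (hS : KernelFamily K S) (ε : ℝ) : ∀ y ∉ K, ∀ x, S ε y x = 0 := by
  induction hS with
  | of hA _ _ => intro y hy x; simp [hA.zero y hy x]
  | add _ _ ihS ihT => intro y hy x; simp [ihS y hy x, ihT y hy x]

theorem contDiff (hS : KernelFamily K S) {ε : ℝ} (hε : 0 < ε) :
    ContDiff ℝ ∞ (Function.uncurry (S ε)) := by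
  induction hS with
  | of hA h₁ h₂ => exact hA.contDiff.mul (contDiff_damped_zero h₁ h₂ hε)
  | add _ _ ihS ihT => exact ihS.add ihT

theorem integrable (hK : IsCompact K) (hS : KernelFamily K S) {ε : ℝ} (hε : 0 < ε)
    (x : Spacetime d × Spacetime d) : Integrable fun y => S ε y x :=
  integrable_of_compact_support hK (fun y hy => hS.zero_of_notMem ε y hy x)
    ((hS.contDiff hε).continuous.comp (Continuous.prodMk_left x))

theorem convergesAt (hK : IsCompact K) (hS : KernelFamily K S) {p : Spacetime d × Spacetime d}
    (hp : ∀ y ∈ K, IsRegularPair y p) : ConvergesAt (fun ε x => ∫ y, S ε y x) p := by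
  induction hS with
  | of hA h₁ h₂ => exact convergesAt_of_isRegularPair hK h₁ h₂ hp hA
  | add hS hT ihS ihT =>
    exact (ihS.add ihT).congr fun ε hε x =>
      (integral_add (hS.integrable hK hε x) (hT.integrable hK hε x)).symm

/-- The derivative hits `A`, `F₁` or `F₂`; in the last two cases it yields `F'`, again of moderate
growth, times the smooth factor `dσ`. One `T` serves all `ε`. -/
theorem exists_fderiv (hK : IsClosed K) (hS : KernelFamily K S) (e : Spacetime d × Spacetime d) :
    ∃ T, KernelFamily K T ∧ ∀ ε > 0, ∀ y x,
      fderiv ℝ (Function.uncurry (S ε)) (y, x) (0, e) = T ε y x := by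
  induction hS with
  | @of A F₁ F₂ hA h₁ h₂ =>
    have hb : ∀ e' : Spacetime d, ∀ π : Spacetime d × Spacetime d →L[ℝ] Spacetime d,
        ContDiff ℝ ∞ fun q : Spacetime d × (Spacetime d × Spacetime d) =>
          ((fderiv ℝ sigma (q.1 - π q.2) (-e') : ℝ) : ℂ) := by
      intro e' π
      refine Complex.ofRealCLM.contDiff.comp ?_
      have h1 : ContDiff ℝ ∞ fun w : Spacetime d => fderiv ℝ sigma w (-e') :=
        ((contDiff_sigma (n := ∞)).fderiv_right (m := ∞) (by simp)).clm_apply contDiff_const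
      exact h1.comp (contDiff_fst.sub (π.contDiff.comp contDiff_snd))
    refine ⟨_, ((KernelFamily.of (hA.fderiv hK (0, e)) h₁ h₂).add
      (KernelFamily.of (hA.smul (hb e.1 (.fst ℝ _ _))) h₁.deriv h₂)).add
      (KernelFamily.of (hA.smul (hb e.2 (.snd ℝ _ _))) h₁ h₂.deriv), fun ε hε y x => ?_⟩
    have hQ : ∀ {F : ℂ → ℂ}, HasModerateGrowth F →
        ∀ π : Spacetime d × Spacetime d →L[ℝ] Spacetime d,
        ∃ L : Spacetime d × (Spacetime d × Spacetime d) →L[ℝ] ℂ,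
        HasFDerivAt (fun q : Spacetime d × (Spacetime d × Spacetime d) =>
          F (phase 0 (q.1 - π q.2) 0 ε)) L (y, x) ∧
        L (0, e) = ((fderiv ℝ sigma (y - π x) (-(π e)) : ℝ) : ℂ) *
          deriv F (phase 0 (y - π x) 0 ε) := by
      intro F hF π
      have hz : phase 0 (y - π x) 0 ε ∈ slitUpper :=
        mem_slitUpper_of_im_pos (by rw [phase_im]; simpa using hε)
      have h1 : HasFDerivAt sigma (fderiv ℝ sigma (y - π x)) (y - π x) :=
        ((contDiff_sigma (n := 1)).differentiable (by simp) _).hasFDerivAt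
      have h2 : HasFDerivAt (fun q : Spacetime d × (Spacetime d × Spacetime d) => q.1 - π q.2)
          (ContinuousLinearMap.fst ℝ _ _ - π.comp (ContinuousLinearMap.snd ℝ _ _)) (y, x) :=
        hasFDerivAt_fst.sub (π.hasFDerivAt.comp _ hasFDerivAt_snd)
      have h3 : HasFDerivAt (fun q : Spacetime d × (Spacetime d × Spacetime d) =>
          phase 0 (q.1 - π q.2) 0 ε) (Complex.ofRealCLM.comp ((fderiv ℝ sigma (y - π x)).comp
          (ContinuousLinearMap.fst ℝ _ _ - π.comp (ContinuousLinearMap.snd ℝ _ _)))) (y, x) := by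
        simp only [phase_zero]
        exact (Complex.ofRealCLM.hasFDerivAt.comp (y, x)
          (HasFDerivAt.comp (g := sigma) (y, x) h1 h2)).add_const _
      refine ⟨_, ((hF.hasDerivAt hz).hasFDerivAt.restrictScalars ℝ).comp (g := F) (y, x) h3, ?_⟩
      simp
    obtain ⟨L₁, hL₁, hL₁'⟩ := hQ h₁ (.fst ℝ _ _)
    obtain ⟨L₂, hL₂, hL₂'⟩ := hQ h₂ (.snd ℝ _ _)
    have hAd := (hA.contDiff.differentiable (by simp) (y, x)).hasFDerivAt
    have := (hAd.mul (hL₁.mul hL₂)).fderiv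
    have e0 : (Function.uncurry fun (y : Spacetime d) (x : Spacetime d × Spacetime d) =>
        A y x * damped F₁ F₂ 0 0 ε y x) = (Function.uncurry A *
        ((fun q => F₁ (phase 0 (q.1 - ContinuousLinearMap.fst ℝ _ _ q.2) 0 ε)) *
        fun q => F₂ (phase 0 (q.1 - ContinuousLinearMap.snd ℝ _ _ q.2) 0 ε))) := rfl
    rw [e0, this]
    simp only [add_apply, smul_apply, hL₁', hL₂',
      Pi.mul_apply, smul_eq_mul, damped, ContinuousLinearMap.coe_fst',
      ContinuousLinearMap.coe_snd', Function.uncurry]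
    ring
  | add hS hT ihS ihT =>
    obtain ⟨T₁, hT₁, h₁⟩ := ihS
    obtain ⟨T₂, hT₂, h₂⟩ := ihT
    refine ⟨_, hT₁.add hT₂, fun ε hε y x => ?_⟩
    rw [← h₁ ε hε, ← h₂ ε hε]
    have := (((hS.contDiff hε).differentiable (by simp) (y, x)).hasFDerivAt.add
      ((hT.contDiff hε).differentiable (by simp) (y, x)).hasFDerivAt).fderiv
    exact congrArg (fun L => L (0, e)) this

/-- Induction on `n`: the partial derivatives of the limit are limits of integrals of families
again, to which the induction hypothesis applies. -/
theorem contDiffOn_limit (hK : IsCompact K) {O : Set (Spacetime d × Spacetime d)} (hO : IsOpen O)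
    (hreg : ∀ p ∈ O, ∀ y ∈ K, IsRegularPair y p) (n : ℕ) (hS : KernelFamily K S)
    {θ : Spacetime d × Spacetime d → ℂ}
    (hθ : ∀ p ∈ O, Tendsto (Function.uncurry fun ε x => ∫ y, S ε y x)
      (𝓝[>] (0 : ℝ) ×ˢ 𝓝 p) (𝓝 (θ p))) : ContDiffOn ℝ n θ O := by
  induction n generalizing S θ with
  | zero => exact contDiffOn_zero.2 (continuousOn_of_tendsto_nhdsGT hθ)
  | succ n ih =>
    let b := Module.finBasis ℝ (Spacetime d × Spacetime d)
    let c := fun i => LinearMap.toContinuousLinearMap (b.coord i)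
    choose T hT hTS using fun i => hS.exists_fderiv hK.isClosed (b i)
    choose! h₀ hh₀ using fun i p (hp : p ∈ O) => (hT i).convergesAt hK (hreg p hp)
    have hder : ∀ ε > 0, ∀ p, HasFDerivAt (fun x => ∫ y, S ε y x)
        (∑ i, (c i).smulRight (∫ y, T i ε y p)) p := by
      intro ε hε p
      obtain ⟨L, hL, hLe⟩ := exists_hasFDerivAt_integral_of_compact_support (μ := volume) hK
        (S := fun x y => S ε y x) (p₀ := p) (fun x y hy => hS.zero_of_notMem ε y hy x)
        fun y _ => ((hS.contDiff hε).comp (contDiff_snd.prodMk contDiff_fst)).contDiffAt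
      have hLb : ∀ i, L (b i) = ∫ y, T i ε y p := by
        intro i
        rw [hLe]
        congr 1
        ext y
        rw [← hTS i ε hε y p]
        have hd := ((hS.contDiff hε).differentiable (by simp) (y, p)).hasFDerivAt
        have hsw : HasFDerivAt (fun q : (Spacetime d × Spacetime d) × Spacetime d => q.swap)
          ((ContinuousLinearMap.snd ℝ _ _).prod (ContinuousLinearMap.fst ℝ _ _)) (p, y) :=
          hasFDerivAt_snd.prodMk hasFDerivAt_fst
        have := (HasFDerivAt.comp (p, y) (f := Prod.swap) hd hsw).fderiv
        have e0 : (Function.uncurry fun x y => S ε y x) = Function.uncurry (S ε) ∘ Prod.swap := rfl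
        rw [e0, this]
        simp
      have hLc : ∑ i, (c i).smulRight (∫ y, T i ε y p) = L := by
        refine ContinuousLinearMap.ext fun e => ?_
        conv_rhs => rw [← b.sum_repr e, map_sum]
        simp [c, hLb]
      rw [hLc]
      exact hL
    have hfd := hasFDerivAt_of_tendsto_nhdsGT c hO hθ hh₀ hder
    push_cast
    rw [contDiffOn_succ_iff_fderiv_of_isOpen hO]
    refine ⟨fun p hp => (hfd p hp).differentiableAt.differentiableWithinAt, by simp, ?_⟩
    have : ContDiffOn ℝ n (fun p => ∑ i, (c i).smulRight (h₀ i p)) O :=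
      ContDiffOn.sum fun i _ => (ContinuousLinearMap.smulRightL ℝ _ ℂ (c i)).contDiff.comp_contDiffOn
        (ih (hT i) (hh₀ i))
    exact this.congr fun p hp => (hfd p hp).fderiv

end KernelFamily

end Families

/-! ### Smearing a distribution with translates of a test function -/

section Taylor

variable {E G : Type*} [NormedAddCommGroup E] [NormedSpace ℝ E] [NormedAddCommGroup G]
  [NormedSpace ℝ G]

/-- The mean value inequality is applied twice, giving `M` in place of the sharp `M / 2`, which
suffices here. -/
theorem norm_sub_sub_fderiv_le {f : E → G} (hf : ContDiff ℝ 2 f) {M : ℝ}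
    (hM : ∀ z, ‖fderiv ℝ (fderiv ℝ f) z‖ ≤ M) (u h : E) :
    ‖f (u + h) - f u - fderiv ℝ f u h‖ ≤ M * ‖h‖ * ‖h‖ := by
  have hd : Differentiable ℝ (fderiv ℝ f) :=
    (hf.fderiv_right (m := 1) (by norm_num)).differentiable (by simp)
  have h1 : ∀ z ∈ Metric.closedBall u ‖h‖, ‖fderiv ℝ f z - fderiv ℝ f u‖ ≤ M * ‖h‖ := by
    intro z hz
    have hM0 : 0 ≤ M := (norm_nonneg (fderiv ℝ (fderiv ℝ f) u)).trans (hM u)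
    refine (Convex.norm_image_sub_le_of_norm_fderiv_le (𝕜 := ℝ) (fun x _ => hd x)
      (fun x _ => hM x) convex_univ (mem_univ u) (mem_univ z)).trans ?_
    gcongr
    simpa [dist_eq_norm] using hz
  have := Convex.norm_image_sub_le_of_norm_fderiv_le' (𝕜 := ℝ)
    (fun x _ => hf.differentiable (by simp) x) h1 (convex_closedBall u ‖h‖)
    (Metric.mem_closedBall_self (norm_nonneg h)) (y := u + h) (by simp)
  simpa using this

theorem exists_norm_sub_sub_fderiv_le {f : E → G} (hf : ContDiff ℝ 2 f)
    (hc : HasCompactSupport f) :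
    ∃ M, 0 ≤ M ∧ ∀ u h, ‖f (u + h) - f u - fderiv ℝ f u h‖ ≤ M * ‖h‖ * ‖h‖ := by
  obtain ⟨M, hM⟩ := Continuous.bounded_above_of_compact_support
    ((hf.fderiv_right (m := 1) (by norm_num)).continuous_fderiv (by simp))
    ((hc.fderiv ℝ).fderiv ℝ)
  exact ⟨M, (norm_nonneg (fderiv ℝ (fderiv ℝ f) 0)).trans (hM 0),
    norm_sub_sub_fderiv_le hf hM⟩

theorem fderiv_fderiv_apply_comm {f : E → G} (hf : ContDiff ℝ 2 f) (x a b : E) :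
    fderiv ℝ (fderiv ℝ f) x a b = fderiv ℝ (fderiv ℝ f) x b a :=
  (hf.contDiffAt.isSymmSndFDerivAt (by simp)) a b

/-- Symmetry of second derivatives, inductively. It makes each derivative of a Taylor remainder of
`f` the Taylor remainder of that derivative. -/
theorem iteratedFDeriv_fderiv_apply {f : E → G} (hf : ContDiff ℝ ∞ f) (h : E) (n : ℕ) :
    iteratedFDeriv ℝ n (fun u => fderiv ℝ f u h) =
      fun u => fderiv ℝ (iteratedFDeriv ℝ n f) u h := by
  induction n with
  | zero =>
    ext u m
    let J := (continuousMultilinearCurryFin0 ℝ E G).symm.toContinuousLinearEquiv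
    have h1 : fderiv ℝ (iteratedFDeriv ℝ 0 f) u =
        (J : G →L[ℝ] _).comp (fderiv ℝ f u) := by
      rw [iteratedFDeriv_zero_eq_comp]
      exact (J.hasFDerivAt.comp u (hf.differentiable (by simp) u).hasFDerivAt).fderiv
    rw [h1]
    simp [J]
  | succ n ih =>
    ext u m
    set Ψ := iteratedFDeriv ℝ n f with hΨ
    have hΨs : ContDiff ℝ ∞ Ψ := hf.iteratedFDeriv_right (m := ∞) (by
      exact_mod_cast le_top (a := ((⊤ : ℕ∞) + (n : ℕ∞))))
    have hd : DifferentiableAt ℝ (fderiv ℝ Ψ) u :=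
      (hΨs.fderiv_right (m := 1) (by norm_cast)).differentiable (by simp) u
    have h2 : fderiv ℝ (fun u => fderiv ℝ Ψ u h) u (m 0) =
        fderiv ℝ (fderiv ℝ Ψ) u (m 0) h := by
      rw [(hd.hasFDerivAt.clm_apply (hasFDerivAt_const h u)).fderiv]
      simp
    have h3 : DifferentiableAt ℝ (iteratedFDeriv ℝ (n + 1) f) u :=
      (hf.iteratedFDeriv_right (m := 1) (i := n + 1) (by
        exact_mod_cast le_top (a := (1 + (n + 1 : ℕ) : ℕ∞)))).differentiable (by simp) u
    have e1 := (ContinuousMultilinearMap.apply ℝ (fun _ : Fin (n + 1) => E) G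
      m).hasFDerivAt.comp u h3.hasFDerivAt
    have e2 := (ContinuousMultilinearMap.apply ℝ (fun _ : Fin n => E) G
      (Fin.tail m)).hasFDerivAt.comp u (hd.hasFDerivAt.clm_apply (hasFDerivAt_const (m 0) u))
    have e3 : (ContinuousMultilinearMap.apply ℝ (fun _ : Fin (n + 1) => E) G m) ∘
        iteratedFDeriv ℝ (n + 1) f = (ContinuousMultilinearMap.apply ℝ (fun _ : Fin n => E) G
        (Fin.tail m)) ∘ fun u => fderiv ℝ Ψ u (m 0) :=
      funext fun u => iteratedFDeriv_succ_apply_left m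
    rw [e3] at e1
    have e4 := congrArg (fun L => L h) (e1.unique e2)
    have e5 : fderiv ℝ (iteratedFDeriv ℝ (n + 1) f) u h m =
        fderiv ℝ (fderiv ℝ Ψ) u h (m 0) (Fin.tail m) := by
      simpa using e4
    rw [iteratedFDeriv_succ_apply_left, ih, h2, e5,
      fderiv_fderiv_apply_comm (hΨs.of_le (by norm_cast))]

theorem norm_iteratedFDeriv_comp_sub_left (f : E → G) (y w : E) (n : ℕ) :
    ‖iteratedFDeriv ℝ n (fun w => f (y - w)) w‖ = ‖iteratedFDeriv ℝ n f (y - w)‖ := by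
  have h1 : (fun w => f (y - w)) = (fun z => f (y + z)) ∘ LinearIsometryEquiv.neg ℝ := by
    ext w; simp [sub_eq_add_neg]
  rw [h1, LinearIsometryEquiv.norm_iteratedFDeriv_comp_right, iteratedFDeriv_comp_add_left]
  simp [sub_eq_add_neg]

end Taylor

section Smeared

variable {d : ℕ}

theorem test_contDiff (f : Test d) : ContDiff ℝ ∞ (f : Spacetime d → ℝ) := f.contDiff

theorem lineDeriv_test_apply (f : Test d) (h x : Spacetime d) :
    (∂_{h} f : Test d) x = fderiv ℝ f x h := by
  have h1 : (∂_{h} f : Test d) x = lineDeriv ℝ f x h := by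
    rw [TestFunction.lineDerivOp_eq_lineDerivCLM (𝕜 := ℝ), TestFunction.lineDerivCLM_apply]
    simp
  rw [h1, ((test_contDiff f).differentiable (by simp) x).lineDeriv_eq_fderiv]

theorem reflectTranslate_apply (y : Spacetime d) (f : Test d) (w : Spacetime d) :
    reflectTranslate y f w = f (y - w) := rfl

/-- A distribution restricted to test functions supported in a compact set has finite order. -/
theorem exists_norm_apply_le (E : Distr d) (K : Compacts (Spacetime d)) :
    ∃ (s : Finset ℕ) (C : ℝ), 0 ≤ C ∧ ∀ g : Test d, (∀ x ∉ K, g x = 0) → ∀ B : ℝ, 0 ≤ B →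
      (∀ i ∈ s, ∀ x, ‖iteratedFDeriv ℝ i g x‖ ≤ B) → ‖E g‖ ≤ C * B := by
  have hK : (K : Set (Spacetime d)) ⊆ (⊤ : Opens (Spacetime d)) := fun _ _ => trivial
  let T : ContDiffMapSupportedIn (Spacetime d) ℝ ⊤ K →L[ℝ] ℂ :=
    E.comp (TestFunction.ofSupportedInCLM ℝ hK)
  let q : Seminorm ℝ (ContDiffMapSupportedIn (Spacetime d) ℝ ⊤ K) :=
    (normSeminorm ℝ ℂ).comp T.toLinearMap
  have hq : Continuous q := continuous_norm.comp T.continuous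
  obtain ⟨s, C, -, hC⟩ := Seminorm.bound_of_continuous
    (ContDiffMapSupportedIn.withSeminorms ℝ (Spacetime d) ℝ ⊤ K) q hq
  refine ⟨s, C, C.2, fun g hg B hB hgB => ?_⟩
  let g' : ContDiffMapSupportedIn (Spacetime d) ℝ ⊤ K := ⟨g, g.contDiff, fun x hx => hg x hx⟩
  have h1 : q g' = ‖E g‖ := rfl
  rw [← h1]
  refine (hC g').trans ?_
  have h2 : (s.sup (ContDiffMapSupportedIn.seminorm ℝ (Spacetime d) ℝ ⊤ K)) g' ≤ B := by
    refine Seminorm.finset_sup_apply_le hB fun i hi => ?_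
    rw [ContDiffMapSupportedIn.seminorm_top_le_iff ℝ hB]
    exact fun x _ => hgB i hi x
  exact mul_le_mul_of_nonneg_left h2 C.2

/-- The differential at `y` of the smeared distribution. -/
def smearedDeriv (E : Distr d) (f : Test d) (y : Spacetime d) : Spacetime d →L[ℝ] ℂ :=
  LinearMap.toContinuousLinearMap
    { toFun := fun h => smeared E (∂_{h} f) y
      map_add' := fun h h' => by
        simp only [smeared]
        rw [← map_add]
        congr 1
        ext w
        simp [reflectTranslate_apply, lineDeriv_test_apply]
      map_smul' := fun c h => by
        simp only [smeared, RingHom.id_apply]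
        rw [← map_smul]
        congr 1
        ext w
        simp [reflectTranslate_apply, lineDeriv_test_apply] }

theorem smearedDeriv_apply (E : Distr d) (f : Test d) (y h : Spacetime d) :
    smearedDeriv E f y h = smeared E (∂_{h} f) y := rfl

/-- By finite order on a fixed compact set, `E` of the first-order Taylor remainder is controlled by
finitely many of its derivatives, each `O(‖h‖²)`. -/
theorem hasFDerivAt_smeared (E : Distr d) (f : Test d) (y : Spacetime d) :
    HasFDerivAt (smeared E f) (smearedDeriv E f y) y := by
  have hfs : IsCompact (tsupport f) := f.hasCompactSupport
  -- Contains the supports of all reflected translates by `y + h` with `‖h‖ ≤ 1`.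
  let K : Compacts (Spacetime d) := ⟨(fun q : Spacetime d × Spacetime d => y + q.1 - q.2) ''
    (Metric.closedBall 0 1 ×ˢ tsupport f),
    ((isCompact_closedBall 0 1).prod hfs).image (by fun_prop)⟩
  have hKmem : ∀ w ∉ K, ∀ h, ‖h‖ ≤ 1 → y + h - w ∉ tsupport f := by
    intro w hw h hh hmem
    exact hw ⟨(h, y + h - w), ⟨by simpa using hh, hmem⟩, by simp⟩
  obtain ⟨s, C, hC0, hC⟩ := exists_norm_apply_le E K
  have hΨ : ∀ i, ContDiff ℝ ∞ (iteratedFDeriv ℝ i f) := fun i =>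
    (test_contDiff f).iteratedFDeriv_right (m := ∞) (by
      exact_mod_cast le_top (a := ((⊤ : ℕ∞) + (i : ℕ∞))))
  choose M hM0 hM using fun i => exists_norm_sub_sub_fderiv_le ((hΨ i).of_le (by norm_cast))
    (f.hasCompactSupport.iteratedFDeriv (𝕜 := ℝ) i)
  have key : ∀ h, ‖h‖ ≤ 1 → ‖smeared E f (y + h) - smeared E f y - smearedDeriv E f y h‖ ≤
      C * (∑ i ∈ s, M i) * ‖h‖ ^ 2 := by
    intro h hh
    let g : Test d := reflectTranslate (y + h) f - reflectTranslate y f -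
      reflectTranslate y (∂_{h} f)
    have hg : smeared E f (y + h) - smeared E f y - smearedDeriv E f y h = E g := by
      simp only [g, map_sub]; rfl
    let F : Spacetime d → ℝ := fun u => f (u + h) - f u - fderiv ℝ f u h
    have hgF : (g : Spacetime d → ℝ) = fun w => F (y - w) := by
      ext w
      change f (y + h - w) - f (y - w) - (∂_{h} f : Test d) (y - w) = _
      rw [lineDeriv_test_apply, add_sub_right_comm]
    have hF : ∀ i u, iteratedFDeriv ℝ i F u = iteratedFDeriv ℝ i f (u + h) -
        iteratedFDeriv ℝ i f u - fderiv ℝ (iteratedFDeriv ℝ i f) u h := by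
      intro i u
      have hf := (test_contDiff f).of_le (show (i : WithTop ℕ∞) ≤ ∞ by exact_mod_cast le_top)
      have hf1 : ContDiff ℝ i fun u => f (u + h) := hf.comp (contDiff_id.add contDiff_const)
      have hf2 : ContDiff ℝ i fun u => fderiv ℝ f u h :=
        (((test_contDiff f).fderiv_right (m := ∞) (by simp)).clm_apply contDiff_const).of_le
          (by exact_mod_cast le_top)
      rw [← iteratedFDeriv_comp_add_right i h u,
        ← congrFun (iteratedFDeriv_fderiv_apply (test_contDiff f) h i) u]
      have e1 := iteratedFDeriv_sub_apply (hf1.sub hf).contDiffAt hf2.contDiffAt (x := u)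
      have e2 := iteratedFDeriv_sub_apply hf1.contDiffAt hf.contDiffAt (x := u)
      rw [← e2]
      exact e1
    rw [hg, mul_assoc]
    refine hC g (fun w hw => ?_) _
      (mul_nonneg (Finset.sum_nonneg fun i _ => hM0 i) (sq_nonneg _)) fun i hi w => ?_
    · have h0 : f (y + h - w) = 0 := image_eq_zero_of_notMem_tsupport (hKmem w hw h hh)
      have h1 : y - w ∉ tsupport f := by simpa using hKmem w hw 0 (by simp)
      have h2 : f (y - w) = 0 := image_eq_zero_of_notMem_tsupport h1
      have h3 : fderiv ℝ f (y - w) = 0 := image_eq_zero_of_notMem_tsupport fun hmem =>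
        h1 (tsupport_fderiv_subset ℝ hmem)
      rw [hgF]
      simp only [F, h2, h3, show y - w + h = y + h - w by abel, h0]
      simp
    · rw [hgF, norm_iteratedFDeriv_comp_sub_left, hF]
      refine (hM i _ _).trans ?_
      rw [mul_assoc, ← sq]
      gcongr
      exact Finset.single_le_sum (fun j _ => hM0 j) hi
  rw [hasFDerivAt_iff_isLittleO_nhds_zero]
  refine Asymptotics.IsBigO.trans_isLittleO (g := fun h : Spacetime d => ‖h‖ ^ 2) ?_
    (Asymptotics.isLittleO_norm_pow_id one_lt_two)
  refine Asymptotics.IsBigO.of_bound (C * (∑ i ∈ s, M i)) ?_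
  filter_upwards [Metric.closedBall_mem_nhds (0 : Spacetime d) one_pos] with h hh
  simpa using key h (by simpa using hh)

theorem contDiff_smeared (E : Distr d) (f : Test d) : ContDiff ℝ ∞ (smeared E f) := by
  rw [contDiff_infty]
  intro n
  induction n generalizing f with
  | zero =>
    exact contDiff_zero.2 (continuous_iff_continuousAt.2 fun y =>
      (hasFDerivAt_smeared E f y).continuousAt)
  | succ n ih =>
    push_cast
    rw [contDiff_succ_iff_fderiv]
    refine ⟨fun y => (hasFDerivAt_smeared E f y).differentiableAt, by simp, ?_⟩
    rw [contDiff_clm_apply_iff]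
    intro h
    have : (fun y => fderiv ℝ (smeared E f) y h) = smeared E (∂_{h} f) := by
      ext y; rw [(hasFDerivAt_smeared E f y).fderiv, smearedDeriv_apply]
    rw [this]
    exact ih _

theorem fderiv_smeared_apply (E : Distr d) (f : Test d) (y h : Spacetime d) :
    fderiv ℝ (smeared E f) y h = smeared E (∂_{h} f) y := by
  rw [(hasFDerivAt_smeared E f y).fderiv, smearedDeriv_apply]

end Smeared

/-! ### Null-convex sets -/

section NullConvex

variable {d : ℕ}

theorem exists_polar_eq_inner (u : Spacetime d) :
    ∃ v : Spacetime d, ∀ w, polar v w = inner ℝ u w := by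
  refine ⟨WithLp.toLp 2 fun μ => eta μ * u μ, fun w => ?_⟩
  rw [PiLp.inner_apply]
  refine Finset.sum_congr rfl fun μ _ => ?_
  have := eta_mul_self μ
  simp only [RCLike.inner_apply, conj_trivial]
  linear_combination (u μ * w μ) * this

/-- For a single kernel the two conditions coincide, so regularity needs only distinct points. This
gives convergence of smeared kernels off the support of the test function. -/
theorem isRegularPair_self {x y : Spacetime d} (h : x ≠ y) : IsRegularPair x (y, y) := by
  obtain ⟨v, hv⟩ := exists_polar_eq_inner (x - y)
  have : 0 < inner ℝ (x - y) (x - y) := real_inner_self_pos.2 (sub_ne_zero.2 h)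
  exact Or.inl ⟨v, by simpa only [hv] using this, by simpa only [hv] using this⟩

/-- Translating the whole segment by a small `y' - y` keeps its endpoints in `B` and its direction
null. -/
theorem NullConvex.segment_subset_interior {B : Set (Spacetime d)} (hB : NullConvex B)
    {a b : Spacetime d} (ha : a ∈ interior B) (hb : b ∈ interior B) (hs : sigma (b - a) = 0) :
    segment ℝ a b ⊆ interior B := by
  intro y hy
  rw [mem_interior_iff_mem_nhds]
  have h : ∀ c ∈ interior B, ∀ᶠ y' in 𝓝 y, c + (y' - y) ∈ B := by
    intro c hc
    have hcont : ContinuousAt (fun y' => c + (y' - y)) y := by fun_prop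
    exact hcont.eventually (by simpa using mem_interior_iff_mem_nhds.1 hc)
  filter_upwards [h a ha, h b hb] with y' ha' hb'
  refine hB _ ha' _ hb' (by simpa using hs) ?_
  obtain ⟨s, t, hs0, ht0, hst, rfl⟩ := hy
  refine ⟨s, t, hs0, ht0, hst, ?_⟩
  rw [smul_add, smul_add, add_add_add_comm, ← add_smul, hst, one_smul]
  abel

theorem NullConvex.isRegularPair {B : Set (Spacetime d)} (hB : NullConvex B)
    {p : Spacetime d × Spacetime d} (hp : p ∈ interior B ×ˢ interior B) {y : Spacetime d}
    (hy : y ∉ interior B) : IsRegularPair y p := by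
  set w₁ := y - p.1 with hw₁
  set w₂ := y - p.2 with hw₂
  have h1 : w₁ ≠ 0 := sub_ne_zero.2 fun h => hy (h ▸ hp.1)
  have h2 : w₂ ≠ 0 := sub_ne_zero.2 fun h => hy (h ▸ hp.2)
  have n1 : 0 < ‖w₁‖ := norm_pos_iff.2 h1
  have n2 : 0 < ‖w₂‖ := norm_pos_iff.2 h2
  by_cases hpos : 0 < ‖w₁‖ * ‖w₂‖ + inner ℝ w₁ w₂
  · obtain ⟨v, hv⟩ := exists_polar_eq_inner (‖w₂‖ • w₁ + ‖w₁‖ • w₂)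
    refine Or.inl ⟨v, ?_, ?_⟩
    · rw [hv, ← hw₁, inner_add_left, real_inner_smul_left, real_inner_smul_left,
        real_inner_self_eq_norm_sq, real_inner_comm]
      nlinarith [mul_pos n1 hpos]
    · rw [hv, ← hw₂, inner_add_left, real_inner_smul_left, real_inner_smul_left,
        real_inner_self_eq_norm_sq]
      nlinarith [mul_pos n2 hpos]
  · have hanti : ‖w₂‖ • w₁ = -(‖w₁‖ • w₂) := by
      have h3 : inner ℝ w₁ (-w₂) = ‖w₁‖ * ‖-w₂‖ := by
        rw [inner_neg_right, norm_neg]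
        have := neg_le_of_abs_le (abs_real_inner_le_norm w₁ w₂)
        linarith [not_lt.1 hpos]
      have := inner_eq_norm_mul_iff_real.1 h3
      rwa [norm_neg, smul_neg] at this
    have hsig : ‖w₂‖ ^ 2 * sigma w₁ = ‖w₁‖ ^ 2 * sigma w₂ := by
      rw [← sigma_smul, ← sigma_smul, hanti, sigma_neg]
    by_cases hs : sigma w₁ = 0
    · exfalso
      -- Hence `p.2 - p.1` is a positive multiple of the null vector `w₁`, and `y` lies on a null
      -- segment with endpoints in the interior.
      have hdir : ‖w₁‖ • (p.2 - p.1) = (‖w₁‖ + ‖w₂‖) • w₁ := by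
        have : p.2 - p.1 = w₁ - w₂ := by rw [hw₁, hw₂]; abel
        rw [this, smul_sub, add_smul, hanti, sub_eq_add_neg]
      have hs0 : sigma (p.2 - p.1) = 0 := by
        have := congrArg sigma hdir
        rw [sigma_smul, sigma_smul, hs, mul_zero] at this
        exact (mul_eq_zero.1 this).resolve_left (by positivity)
      refine hy (hB.segment_subset_interior hp.1 hp.2 hs0 ?_)
      have hsum : 0 < ‖w₁‖ + ‖w₂‖ := by positivity
      rw [segment_eq_image']
      refine ⟨‖w₁‖ / (‖w₁‖ + ‖w₂‖), ⟨by positivity, div_le_one_of_le₀ (by linarith) hsum.le⟩, ?_⟩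
      have : (‖w₁‖ / (‖w₁‖ + ‖w₂‖)) • (p.2 - p.1) = w₁ := by
        rw [div_eq_inv_mul, mul_smul, hdir, smul_smul, inv_mul_cancel₀ hsum.ne', one_smul]
      change p.1 + (‖w₁‖ / (‖w₁‖ + ‖w₂‖)) • (p.2 - p.1) = y
      rw [this]
      exact add_sub_cancel p.1 y
    · refine Or.inr ⟨hs, fun h => hs ?_⟩
      rw [h, mul_zero] at hsig
      exact (mul_eq_zero.1 hsig).resolve_left (by positivity)

end NullConvex

/-! ### The Hadamard expansion -/

section Hadamard

variable {d : ℕ} {ι : Type*} [Fintype ι]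

/-- A finite sum of smooth coefficients times functions of `σ + iε`. -/
def hadamardSum (a : ι → Spacetime d → ℂ) (F : ι → ℂ → ℂ) (ε : ℝ) (w : Spacetime d) : ℂ :=
  ∑ i, a i w * F i (phase 0 w 0 ε)

/-- The three terms are the power, the logarithm and the constant `1`; `1 ≤ d` makes the exponent
`D/2 - 1` nonnegative, as the growth bound requires. -/
theorem exists_regularizedKernel_eq {U V W : Spacetime d → ℂ} {ℓ : ℝ} (hU : ContDiff ℝ ∞ U)
    (hV : ContDiff ℝ ∞ V) (hW : ContDiff ℝ ∞ W) (hℓ : 0 < ℓ) (hd : 1 ≤ d) :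
    ∃ (a : Fin 3 → Spacetime d → ℂ) (F : Fin 3 → ℂ → ℂ), (∀ i, ContDiff ℝ ∞ (a i)) ∧
      (∀ i, HasModerateGrowth (F i)) ∧
      ∀ ε > 0, ∀ w, regularizedKernel U V W ℓ ε w = hadamardSum a F ε w := by
  set c : ℝ := ((d + 1 : ℕ) : ℝ) / 2 - 1 with hc
  have hc0 : 0 ≤ c := by
    have : (1 : ℝ) ≤ d := by exact_mod_cast hd
    rw [hc]; push_cast; linarith
  refine ⟨![U, V, W], ![fun z => Complex.exp (-(c : ℂ) * upperLog z),
    fun z => upperLog z - (Real.log (ℓ ^ 2) : ℝ), fun _ => 1], ?_, ?_, fun ε hε w => ?_⟩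
  · intro i; fin_cases i <;> assumption
  · intro i
    fin_cases i
    · exact hasModerateGrowth_exp_upperLog hc0
    · exact hasModerateGrowth_upperLog_sub _
    · exact HasModerateGrowth.one
  · have him : 0 < (phase 0 w 0 ε).im := by rw [phase_im]; simpa using hε
    have h0 : phase 0 w 0 ε ≠ 0 := fun h => by simp [h] at him
    have hpow : (((d + 1 : ℕ) : ℂ) / 2 - 1) = (c : ℂ) := by rw [hc]; push_cast; ring
    have hlog : Complex.log (phase 0 w 0 ε / (ℓ : ℂ) ^ 2) =
        Complex.log (phase 0 w 0 ε) - (Real.log (ℓ ^ 2) : ℝ) := by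
      have : phase 0 w 0 ε / (ℓ : ℂ) ^ 2 = (((ℓ ^ 2)⁻¹ : ℝ) : ℂ) * phase 0 w 0 ε := by
        push_cast; field_simp
      rw [this, Complex.log_ofReal_mul (by positivity) h0, Real.log_inv]
      push_cast
      ring
    rw [regularizedKernel, hadamardSum, Fin.sum_univ_three, ← phase_zero 0, hpow, hlog,
      Complex.cpow_def_of_ne_zero h0]
    simp only [Matrix.cons_val_zero, Matrix.cons_val_one, Matrix.cons_val, mul_one,
      upperLog_eq_log him]
    rw [div_eq_mul_inv, ← Complex.exp_neg]
    congr 4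
    ring

theorem KernelFamily.sum {K : Set (Spacetime d)} {κ : Type*} (s : Finset κ)
    {S : κ → ℝ → Spacetime d → Spacetime d × Spacetime d → ℂ} (hS : ∀ i, KernelFamily K (S i)) :
    KernelFamily K fun ε y x => ∑ i ∈ s, S i ε y x := by
  classical
  induction s using Finset.induction_on with
  | empty =>
    have : KernelFamily K _ := KernelFamily.of (K := K) (A := fun _ _ => 0)
      ⟨contDiff_const, fun _ _ _ => rfl⟩ HasModerateGrowth.one HasModerateGrowth.one
    simpa using this
  | insert i s hi ih =>
    simp only [Finset.sum_insert hi]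
    exact (hS i).add ih

variable {a : ι → Spacetime d → ℂ} {F : ι → ℂ → ℂ} {K : Set (Spacetime d)}
  {A : Spacetime d → Spacetime d × Spacetime d → ℂ}

theorem kernelFamily_mul_hadamardSum (ha : ∀ i, ContDiff ℝ ∞ (a i))
    (hF : ∀ i, HasModerateGrowth (F i)) (hA : IsAmplitude K A) :
    KernelFamily K fun ε y x =>
      A y x * (hadamardSum a F ε (y - x.1) * hadamardSum a F ε (y - x.2)) := by
  have h := KernelFamily.sum (K := K) Finset.univ fun i => KernelFamily.sum Finset.univ fun j =>
    KernelFamily.of (hA.smul (b := fun q => a i (q.1 - q.2.1) * a j (q.1 - q.2.2))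
      (((ha i).comp (contDiff_fst.sub contDiff_snd.fst)).mul
        ((ha j).comp (contDiff_fst.sub contDiff_snd.snd)))) (hF i) (hF j)
  convert h using 4 with ε y x
  rw [hadamardSum, hadamardSum, Finset.sum_mul_sum, Finset.mul_sum]
  refine Finset.sum_congr rfl fun i _ => ?_
  rw [Finset.mul_sum]
  refine Finset.sum_congr rfl fun j _ => ?_
  rw [damped]
  ring

theorem kernelFamily_hadamardSum (ha : ∀ i, ContDiff ℝ ∞ (a i))
    (hF : ∀ i, HasModerateGrowth (F i)) (hA : IsAmplitude K A) :
    KernelFamily K fun ε y x => A y x * hadamardSum a F ε (y - x.1) := by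
  have h := KernelFamily.sum (K := K) Finset.univ fun i =>
    KernelFamily.of (hA.smul (b := fun q => a i (q.1 - q.2.1))
      ((ha i).comp (contDiff_fst.sub contDiff_snd.fst))) (hF i) HasModerateGrowth.one
  convert h using 4 with ε y x
  rw [hadamardSum, Finset.mul_sum]
  refine Finset.sum_congr rfl fun i _ => ?_
  rw [damped]
  ring

theorem contDiff_hadamardSum (ha : ∀ i, ContDiff ℝ ∞ (a i)) (hF : ∀ i, HasModerateGrowth (F i))
    {ε : ℝ} (hε : 0 < ε) : ContDiff ℝ ∞ (hadamardSum a F ε) := by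
  refine ContDiff.sum fun i _ => (ha i).mul ?_
  rw [contDiff_iff_contDiffAt]
  intro w
  exact ContDiffAt.comp w ((hF i).contDiffAt (mem_slitUpper_of_im_pos
    (by rw [phase_im]; simpa using hε)))
    (contDiff_phase 0 contDiff_id contDiff_const contDiff_const).contDiffAt

end Hadamard

/-! ### Passing to the limit -/

section PassToLimit

theorem tendsto_integral_mul_of_tendsto_nhdsGT {Z : Type*} [TopologicalSpace Z] [T2Space Z]
    [MeasurableSpace Z] [BorelSpace Z] [SecondCountableTopology Z] {μ : Measure Z}
    [IsFiniteMeasureOnCompacts μ] {C : Set Z} (hC : IsCompact C) {g : ℝ → Z → ℂ} {g₀ : Z → ℂ}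
    (hg : ∀ z ∈ C, Tendsto (Function.uncurry g) (𝓝[>] (0 : ℝ) ×ˢ 𝓝 z) (𝓝 (g₀ z)))
    (hgc : ∀ ε > 0, Continuous (g ε)) {φ : Z → ℂ} (hφ : Continuous φ) (hφ0 : ∀ z ∉ C, φ z = 0) :
    Tendsto (fun ε => ∫ z, φ z * g ε z ∂μ) (𝓝[>] 0) (𝓝 (∫ z, φ z * g₀ z ∂μ)) := by
  obtain ⟨a, ha⟩ := hC.exists_bound_of_continuousOn (continuousOn_of_tendsto_nhdsGT hg)
  obtain ⟨b, hb⟩ := hC.exists_bound_of_continuousOn hφ.continuousOn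
  -- Joint convergence bounds `g ε` near each point, and compactness makes the bound uniform on `C`,
  -- as domination requires.
  have hev : ∀ᶠ ε in 𝓝 (0 : ℝ), ∀ z ∈ C, 0 < ε → ‖g ε z‖ ≤ a + 1 := by
    refine hC.eventually_forall_of_forall_eventually
      (P := fun ε z => 0 < ε → ‖g ε z‖ ≤ a + 1) fun z hz => ?_
    have h1 : ‖g₀ z‖ < a + 1 := by linarith [ha z hz]
    have h2 := (hg z hz).norm.eventually (gt_mem_nhds h1)
    rw [← nhdsWithin_univ z, ← nhdsWithin_prod_eq, eventually_nhdsWithin_iff] at h2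
    exact h2.mono fun q hq hq0 => (hq ⟨hq0, trivial⟩).le
  refine tendsto_integral_filter_of_dominated_convergence (C.indicator fun _ => b * (a + 1))
    ?_ ?_ ?_ ?_
  · filter_upwards [self_mem_nhdsWithin] with ε hε
    exact (hφ.mul (hgc ε hε)).aestronglyMeasurable
  · filter_upwards [self_mem_nhdsWithin, nhdsWithin_le_nhds hev] with ε hε hε'
    refine Eventually.of_forall fun z => ?_
    by_cases hz : z ∈ C
    · rw [norm_mul, indicator_of_mem hz]
      exact mul_le_mul (hb z hz) (hε' z hz hε) (norm_nonneg _) ((norm_nonneg _).trans (hb z hz))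
    · simp [hz, hφ0 z hz]
  · exact (integrable_indicator_iff hC.measurableSet).2 (integrableOn_const hC.measure_lt_top.ne)
  · refine Eventually.of_forall fun z => ?_
    by_cases hz : z ∈ C
    · exact (tendsto_of_tendsto_prod (hg z hz)).const_mul _
    · simp only [hφ0 z hz, zero_mul]; exact tendsto_const_nhds

variable {d : ℕ}

theorem KernelFamily.continuous_integral {K : Set (Spacetime d)} (hK : IsCompact K)
    {S : ℝ → Spacetime d → Spacetime d × Spacetime d → ℂ} (hS : KernelFamily K S) {ε : ℝ}
    (hε : 0 < ε) : Continuous fun x => ∫ y, S ε y x := by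
  rw [continuous_iff_continuousAt]
  intro x
  exact continuousAt_integral_of_compact_support (μ := volume) hK (S := fun x y => S ε y x)
    (fun x y hy => hS.zero_of_notMem ε y hy x) fun y _ => Eventually.of_forall fun q =>
      (((hS.contDiff hε).continuous).comp continuous_swap).continuousAt

theorem phase_neg_zero (w : Spacetime d) (ε : ℝ) : phase 0 (-w) 0 ε = phase 0 w 0 ε := by
  simp only [phase_zero, sigma_neg]

variable {E : Distr d} {a : Fin 3 → Spacetime d → ℂ} {F : Fin 3 → ℂ → ℂ}

/-- The roles are exchanged: the test point `x` is integrated and `p.1` is the parameter. Since `σ`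
is even, only the coefficients have to be reflected. -/
theorem kernelFamily_test (ha : ∀ i, ContDiff ℝ ∞ (a i)) (hF : ∀ i, HasModerateGrowth (F i))
    (f : Test d) : KernelFamily (tsupport f) fun ε (x : Spacetime d)
      (p : Spacetime d × Spacetime d) => (f x : ℂ) * hadamardSum a F ε (p.1 - x) := by
  have hA : IsAmplitude (tsupport f) fun x _ => (f x : ℂ) :=
    ⟨Complex.ofRealCLM.contDiff.comp ((test_contDiff f).comp contDiff_fst),
      fun y hy _ => by simp [image_eq_zero_of_notMem_tsupport hy]⟩
  have := kernelFamily_hadamardSum (a := fun i w => a i (-w)) (fun i => (ha i).comp contDiff_neg)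
    hF hA
  convert this using 5 with ε x p
  simp only [hadamardSum, neg_sub]
  refine Finset.sum_congr rfl fun i _ => ?_
  rw [← phase_neg_zero, neg_sub]

/-- `y ↦ ∫ f(x) k_ε(y - x) dx` for the regularized kernel `k_ε`. -/
def smearedSum (a : Fin 3 → Spacetime d → ℂ) (F : Fin 3 → ℂ → ℂ) (f : Test d) (ε : ℝ)
    (y : Spacetime d) : ℂ :=
  ∫ x, (f x : ℂ) * hadamardSum a F ε (y - x)

theorem continuous_smearedSum (ha : ∀ i, ContDiff ℝ ∞ (a i)) (hF : ∀ i, HasModerateGrowth (F i))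
    (f : Test d) {ε : ℝ} (hε : 0 < ε) : Continuous (smearedSum a F f ε) := by
  have hd : Continuous fun y : Spacetime d => (y, y) := by fun_prop
  have h := ((kernelFamily_test ha hF f).continuous_integral f.hasCompactSupport hε).comp hd
  refine h.congr fun y => ?_
  rfl

/-- The oscillatory integral argument, at the diagonal pair `(y₀, y₀)`, supplies a joint limit;
distributional convergence at the fixed point `y₀` identifies it. -/
theorem tendsto_smeared (ha : ∀ i, ContDiff ℝ ∞ (a i)) (hF : ∀ i, HasModerateGrowth (F i))
    (hE : ∀ f : Test d, Tendsto (fun ε : ℝ => ∫ x, hadamardSum a F ε x * (f x : ℂ)) (𝓝[>] 0)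
      (𝓝 (E f))) (f : Test d) {y₀ : Spacetime d} (hy₀ : y₀ ∉ tsupport f) :
    Tendsto (Function.uncurry (smearedSum a F f)) (𝓝[>] (0 : ℝ) ×ˢ 𝓝 y₀)
      (𝓝 (smeared E f y₀)) := by
  obtain ⟨L, hL⟩ := (kernelFamily_test ha hF f).convergesAt f.hasCompactSupport (p := (y₀, y₀))
    fun x hx => isRegularPair_self fun h => hy₀ (h ▸ hx)
  have hdiag : Tendsto (fun q : ℝ × Spacetime d => (q.1, (q.2, q.2))) (𝓝[>] (0 : ℝ) ×ˢ 𝓝 y₀)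
      (𝓝[>] (0 : ℝ) ×ˢ 𝓝 (y₀, y₀)) :=
    tendsto_fst.prodMk (tendsto_snd.prodMk_nhds tendsto_snd)
  have h1 : Tendsto (Function.uncurry (smearedSum a F f)) (𝓝[>] (0 : ℝ) ×ˢ 𝓝 y₀) (𝓝 L) := by
    refine (hL.comp hdiag).congr fun q => ?_
    rfl
  have h2 := tendsto_of_tendsto_prod h1
  have h3 := hE (reflectTranslate y₀ f)
  have h4 : ∀ ε, ∫ x, hadamardSum a F ε x * (reflectTranslate y₀ f x : ℂ) =
      smearedSum a F f ε y₀ := by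
    intro ε
    rw [smearedSum, ← integral_sub_left_eq_self _ volume y₀]
    congr 1
    ext x
    rw [reflectTranslate_apply, sub_sub_cancel, mul_comm]
  simp only [h4] at h3
  rw [smeared, tendsto_nhds_unique h3 h2]
  exact h1

/-- The scalar version of the main statement: `∫ ψ(y) H_F(y, f₁) H_F(y, f₂) dy` has a smooth
kernel if `ψ` is supported away from the interior of the null-convex set. -/
theorem exists_smooth_kernel (ha : ∀ i, ContDiff ℝ ∞ (a i)) (hF : ∀ i, HasModerateGrowth (F i))
    (hE : ∀ f : Test d, Tendsto (fun ε : ℝ => ∫ x, hadamardSum a F ε x * (f x : ℂ)) (𝓝[>] 0)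
      (𝓝 (E f))) {B : Set (Spacetime d)} (hB : NullConvex B) {ψ : Spacetime d → ℝ}
    (hψ : ContDiff ℝ ∞ ψ) (hψc : HasCompactSupport ψ) (hψB : Disjoint (tsupport ψ) (interior B)) :
    ∃ θ : Spacetime d × Spacetime d → ℂ, ContDiffOn ℝ ∞ θ (interior B ×ˢ interior B) ∧
      ∀ f₁ f₂ : Test d, tsupport f₁ ⊆ interior B → tsupport f₂ ⊆ interior B →
        ∫ y, (ψ y : ℂ) * (smeared E f₁ y * smeared E f₂ y) =
          ∫ p : Spacetime d × Spacetime d, θ p * (f₁ p.1 : ℂ) * (f₂ p.2 : ℂ) := by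
  have hA : IsAmplitude (tsupport ψ) fun y _ => (ψ y : ℂ) :=
    ⟨Complex.ofRealCLM.contDiff.comp (hψ.comp contDiff_fst),
      fun y hy _ => by simp [image_eq_zero_of_notMem_tsupport hy]⟩
  have hK : IsCompact (tsupport ψ) := hψc
  have hS := kernelFamily_mul_hadamardSum ha hF hA
  have hreg : ∀ p ∈ interior B ×ˢ interior B, ∀ y ∈ tsupport ψ, IsRegularPair y p :=
    fun p hp y hy => hB.isRegularPair hp (disjoint_left.1 hψB hy)
  choose! θ hθ using fun p hp => hS.convergesAt hK (hreg p hp)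
  have hO : IsOpen (interior B ×ˢ interior B) := isOpen_interior.prod isOpen_interior
  refine ⟨θ, contDiffOn_infty.2 fun n => hS.contDiffOn_limit hK hO hreg n hθ, ?_⟩
  intro f₁ f₂ hf₁ hf₂
  have hψC : Continuous fun y => (ψ y : ℂ) := Complex.continuous_ofReal.comp hψ.continuous
  have hfC : ∀ f : Test d, Continuous fun y => (f y : ℂ) :=
    fun f => Complex.continuous_ofReal.comp (test_contDiff f).continuous
  have lim₁ := tendsto_integral_mul_of_tendsto_nhdsGT (μ := volume) hK
    (g := fun ε y => smearedSum a F f₁ ε y * smearedSum a F f₂ ε y)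
    (g₀ := fun y => smeared E f₁ y * smeared E f₂ y)
    (fun y hy => ((tendsto_smeared ha hF hE f₁ fun h => disjoint_left.1 hψB hy (hf₁ h)).mul
      (tendsto_smeared ha hF hE f₂ fun h => disjoint_left.1 hψB hy (hf₂ h))))
    (fun ε hε => (continuous_smearedSum ha hF f₁ hε).mul (continuous_smearedSum ha hF f₂ hε)) hψC
    (fun y hy => by simp [image_eq_zero_of_notMem_tsupport hy])
  have hC : IsCompact (tsupport f₁ ×ˢ tsupport f₂) :=
    f₁.hasCompactSupport.isCompact.prod f₂.hasCompactSupport.isCompact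
  have hff0 : ∀ p ∉ tsupport f₁ ×ˢ tsupport f₂, (f₁ p.1 : ℂ) * (f₂ p.2 : ℂ) = 0 := by
    intro p hp
    by_cases h1 : p.1 ∈ tsupport f₁
    · have h2 : p.2 ∉ tsupport f₂ := fun h2 => hp ⟨h1, h2⟩
      simp [image_eq_zero_of_notMem_tsupport h2]
    · simp [image_eq_zero_of_notMem_tsupport h1]
  have hffC : Continuous fun p : Spacetime d × Spacetime d => (f₁ p.1 : ℂ) * (f₂ p.2 : ℂ) :=
    ((hfC f₁).comp continuous_fst).mul ((hfC f₂).comp continuous_snd)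
  have lim₂ := tendsto_integral_mul_of_tendsto_nhdsGT (μ := volume) hC
    (fun p hp => hθ p (prod_mono hf₁ hf₂ hp)) (fun ε hε => hS.continuous_integral hK hε) hffC hff0
  -- Fubini for the smooth kernels at `ε > 0`; its left side tends to the smeared product by `lim₁`,
  -- its right side to the pairing with `θ` by `lim₂`.
  have heq : ∀ ε > 0, ∫ y, (ψ y : ℂ) * (smearedSum a F f₁ ε y * smearedSum a F f₂ ε y) =
      ∫ p : Spacetime d × Spacetime d, ((f₁ p.1 : ℂ) * (f₂ p.2 : ℂ)) *
        ∫ y, (ψ y : ℂ) * (hadamardSum a F ε (y - p.1) * hadamardSum a F ε (y - p.2)) := by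
    intro ε hε
    have hk := (contDiff_hadamardSum ha hF hε).continuous
    have e1 : ∀ y, (ψ y : ℂ) * (smearedSum a F f₁ ε y * smearedSum a F f₂ ε y) =
        ∫ p : Spacetime d × Spacetime d, ((f₁ p.1 : ℂ) * (f₂ p.2 : ℂ)) *
          ((ψ y : ℂ) * (hadamardSum a F ε (y - p.1) * hadamardSum a F ε (y - p.2))) := by
      intro y
      rw [smearedSum, smearedSum, ← integral_prod_mul, ← integral_const_mul, Measure.volume_eq_prod]
      congr 1
      ext p
      ring
    simp_rw [e1, ← integral_const_mul]
    refine integral_integral_swap_of_hasCompactSupport ?_ ?_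
    · have : Continuous fun q : Spacetime d × (Spacetime d × Spacetime d) =>
          ((f₁ q.2.1 : ℂ) * (f₂ q.2.2 : ℂ)) *
          ((ψ q.1 : ℂ) * (hadamardSum a F ε (q.1 - q.2.1) * hadamardSum a F ε (q.1 - q.2.2))) :=
        (hffC.comp continuous_snd).mul ((hψC.comp continuous_fst).mul
          ((hk.comp (by fun_prop)).mul (hk.comp (by fun_prop))))
      exact this
    · refine HasCompactSupport.intro (hK.prod hC) fun q hq => ?_
      by_cases h1 : q.1 ∈ tsupport ψ
      · have := hff0 q.2 fun h => hq ⟨h1, h⟩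
        simp [Function.uncurry, this]
      · simp [Function.uncurry, image_eq_zero_of_notMem_tsupport h1]
  have hfin := tendsto_nhds_unique (lim₁.congr' (by
    filter_upwards [self_mem_nhdsWithin] with ε hε using heq ε hε)) lim₂
  rw [hfin]
  congr 1
  ext p
  ring

end PassToLimit

/-! ### Integration by parts and the gradient of the cutoff -/

section BoundaryIntegral

variable {d : ℕ}

/-- The frontier of `B` may have positive measure, so vanishing on the interior is not enough; at
density points of `B` the derivative is determined by the values on `B`. -/
theorem ae_fderiv_eq_zero_of_eqOn_const {χ : Spacetime d → ℝ} {B : Set (Spacetime d)} {c : ℝ}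
    (hχ : ∀ y ∈ B, χ y = c) (hB : MeasurableSet B) (hd : Differentiable ℝ χ) :
    ∀ᵐ y ∂volume.restrict B, fderiv ℝ χ y = 0 := by
  set e : Spacetime d := basisVec 0 with he
  have he0 : ‖e‖ ≠ 0 := by simp [he, basisVec]
  -- Multiplying by the nonzero vector `e` turns `χ` into a self-map of spacetime, as the
  -- density-point estimate requires.
  have happ : ApproximatesLinearOn (fun y => χ y • e)
      (0 : Spacetime d →L[ℝ] Spacetime d) B 0 := by
    intro x hx y hy
    simp [hχ x hx, hχ y hy]
  have h := happ.norm_fderiv_sub_le volume hB (fun y => (fderiv ℝ χ y).smulRight e)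
    fun y _ => ((hd y).hasFDerivAt.smul_const e).hasFDerivWithinAt
  filter_upwards [h] with y hy
  have h0 : (fderiv ℝ χ y).smulRight e = 0 := by
    rw [sub_zero] at hy
    exact nnnorm_eq_zero.1 (nonpos_iff_eq_zero.1 hy)
  rw [← norm_eq_zero, ContinuousLinearMap.norm_smulRight_apply] at h0
  exact norm_eq_zero.1 ((mul_eq_zero.1 h0).resolve_right he0)

theorem setIntegral_diff_eq_integral {χ : Spacetime d → ℝ} {B₁ B₂ : Set (Spacetime d)}
    (hB₁ : IsCompact B₁) (hB₂ : IsCompact B₂) (hd : Differentiable ℝ χ)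
    (hχ₁ : ∀ y ∈ B₁, χ y = 1) (hχ₂ : ∀ y ∉ B₂, χ y = 0) {G : Spacetime d → ℂ}
    (hG : ∀ y, fderiv ℝ χ y = 0 → G y = 0) : ∫ y in B₂ \ B₁, G y = ∫ y, G y := by
  have hm := hB₁.measurableSet
  rw [← integral_indicator (hB₂.measurableSet.diff hm)]
  refine integral_congr_ae ?_
  filter_upwards [(ae_restrict_iff' hm).1 (ae_fderiv_eq_zero_of_eqOn_const hχ₁ hm hd)] with y hy
  by_cases h : y ∈ B₂ \ B₁
  · rw [indicator_of_mem h]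
  · rw [indicator_of_notMem h]
    refine (hG y ?_).symm
    by_cases h1 : y ∈ B₁
    · exact hy h1
    · have h2 : y ∈ B₂ᶜ := fun h2 => h ⟨h2, h1⟩
      have : χ =ᶠ[𝓝 y] fun _ => 0 :=
        eventually_of_mem (hB₂.isClosed.isOpen_compl.mem_nhds h2) hχ₂
      rw [this.fderiv_eq, fderiv_fun_const]
      rfl

theorem tsupport_lineDeriv_subset (f : Test d) (v : Spacetime d) :
    tsupport (∂_{v} f : Test d) ⊆ tsupport f := by
  have : ((∂_{v} f : Test d) : Spacetime d → ℝ) = fun x => fderiv ℝ f x v :=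
    funext fun x => lineDeriv_test_apply f v x
  rw [this]
  exact tsupport_fderiv_apply_subset ℝ v

theorem contDiff_of_contDiffOn_of_eq_zero {X V : Type*} [NormedAddCommGroup X] [NormedSpace ℝ X]
    [NormedAddCommGroup V] [NormedSpace ℝ V] {n : WithTop ℕ∞} {K O : Set X} (hK : IsClosed K)
    (hO : IsOpen O) (hKO : K ⊆ O) {S : X → V} (hS : ContDiffOn ℝ n S O) (h0 : ∀ x ∉ K, S x = 0) :
    ContDiff ℝ n S := by
  rw [contDiff_iff_contDiffAt]
  intro x
  by_cases hx : x ∈ K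
  · exact hS.contDiffAt (hO.mem_nhds (hKO hx))
  · have : S =ᶠ[𝓝 x] fun _ => 0 := eventually_of_mem (hK.isOpen_compl.mem_nhds hx) h0
    exact contDiffAt_const.congr_of_eventuallyEq this

/-- Although `θ` is smooth only on `U ×ˢ U`, its product with the test functions is globally smooth
with compact support, so its total derivative integrates to zero. -/
theorem integral_mul_lineDeriv_right {U : Set (Spacetime d)} (hU : IsOpen U)
    {θ : Spacetime d × Spacetime d → ℂ} (hθ : ContDiffOn ℝ ∞ θ (U ×ˢ U)) (f₁ f₂ : Test d)
    (h₁ : tsupport f₁ ⊆ U) (h₂ : tsupport f₂ ⊆ U) (v : Spacetime d) :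
    Integrable (fun p : Spacetime d × Spacetime d =>
      fderiv ℝ θ p (0, v) * (f₁ p.1 : ℂ) * (f₂ p.2 : ℂ)) ∧
    ∫ p : Spacetime d × Spacetime d, θ p * (f₁ p.1 : ℂ) * ((∂_{v} f₂ : Test d) p.2 : ℂ) =
      -∫ p : Spacetime d × Spacetime d, fderiv ℝ θ p (0, v) * (f₁ p.1 : ℂ) * (f₂ p.2 : ℂ) := by
  set O := U ×ˢ U with hO'
  set K := tsupport f₁ ×ˢ tsupport f₂ with hK'
  have hO : IsOpen O := hU.prod hU
  have hK : IsCompact K := f₁.hasCompactSupport.isCompact.prod f₂.hasCompactSupport.isCompact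
  have hKO : K ⊆ O := prod_mono h₁ h₂
  have hf : ∀ f : Test d, ContDiff ℝ ∞ fun x => (f x : ℂ) := fun f =>
    Complex.ofRealCLM.contDiff.comp (test_contDiff f)
  have hc₁ : ContDiff ℝ ∞ fun p : Spacetime d × Spacetime d => (f₁ p.1 : ℂ) :=
    (hf f₁).comp contDiff_fst
  have hc₂ : ∀ f : Test d, ContDiff ℝ ∞ fun p : Spacetime d × Spacetime d => (f p.2 : ℂ) :=
    fun f => (hf f).comp contDiff_snd
  have h0 : ∀ f : Test d, tsupport f ⊆ tsupport f₂ → ∀ p ∉ K, (f₁ p.1 : ℂ) * (f p.2 : ℂ) = 0 := by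
    intro f hff p hp
    by_cases hp1 : p.1 ∈ tsupport f₁
    · have hp2 : p.2 ∉ tsupport f := fun h => hp ⟨hp1, hff h⟩
      simp [image_eq_zero_of_notMem_tsupport hp2]
    · simp [image_eq_zero_of_notMem_tsupport hp1]
  have hθ' : ContDiffOn ℝ ∞ (fun p => fderiv ℝ θ p (0, v)) O :=
    (hθ.fderiv_of_isOpen hO (by simp)).clm_apply contDiffOn_const
  have key : ∀ {g : Spacetime d × Spacetime d → ℂ}, ContDiffOn ℝ ∞ g O → ∀ f : Test d,
      tsupport f ⊆ tsupport f₂ →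
      ContDiff ℝ ∞ fun p : Spacetime d × Spacetime d => g p * (f₁ p.1 : ℂ) * (f p.2 : ℂ) :=
    fun hg f hff => contDiff_of_contDiffOn_of_eq_zero hK.isClosed hO hKO
      ((hg.mul hc₁.contDiffOn).mul (hc₂ f).contDiffOn)
      fun p hp => by rw [mul_assoc, h0 f hff p hp, mul_zero]
  have hv := tsupport_lineDeriv_subset f₂ v
  have hi₁ : Integrable (fun p : Spacetime d × Spacetime d =>
      fderiv ℝ θ p (0, v) * (f₁ p.1 : ℂ) * (f₂ p.2 : ℂ)) :=
    integrable_of_compact_support hK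
      (fun p hp => by rw [mul_assoc, h0 f₂ Subset.rfl p hp, mul_zero])
      (key hθ' f₂ Subset.rfl).continuous
  have hi₂ : Integrable (fun p : Spacetime d × Spacetime d =>
      θ p * (f₁ p.1 : ℂ) * ((∂_{v} f₂ : Test d) p.2 : ℂ)) :=
    integrable_of_compact_support hK
      (fun p hp => by rw [mul_assoc, h0 _ hv p hp, mul_zero]) (key hθ _ hv).continuous
  refine ⟨hi₁, eq_neg_of_add_eq_zero_left ?_⟩
  have hS0 : ∀ p ∉ K, θ p * (f₁ p.1 : ℂ) * (f₂ p.2 : ℂ) = 0 := fun p hp => by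
    rw [mul_assoc, h0 f₂ Subset.rfl p hp, mul_zero]
  have : (volume : Measure (Spacetime d × Spacetime d)).IsAddHaarMeasure := by
    rw [Measure.volume_eq_prod]; infer_instance
  rw [← integral_add hi₂ hi₁, ← integral_fderiv_apply_eq_zero (μ := volume) hK hS0
    ((key hθ f₂ Subset.rfl).of_le (by simp)) (0, v)]
  refine integral_congr_ae (Eventually.of_forall fun p => ?_)
  have hd₁ : HasFDerivAt (fun p : Spacetime d × Spacetime d => (f₁ p.1 : ℂ)) _ p :=
    (((hf f₁).differentiable (by simp)) p.1).hasFDerivAt.comp p hasFDerivAt_fst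
  have hd₂ : HasFDerivAt (fun p : Spacetime d × Spacetime d => (f₂ p.2 : ℂ)) _ p :=
    (Complex.ofRealCLM.hasFDerivAt.comp p.2
      (((test_contDiff f₂).differentiable (by simp)) p.2).hasFDerivAt).comp p hasFDerivAt_snd
  by_cases hp : p ∈ O
  · have hdθ : HasFDerivAt θ _ p :=
      ((hθ.contDiffAt (hO.mem_nhds hp)).differentiableAt (by simp)).hasFDerivAt
    have := ((hdθ.mul hd₁).mul hd₂).fderiv
    simp only [Pi.mul_def] at this
    simp only [this, lineDeriv_test_apply]
    simp
    ring
  · have hpK : p ∉ K := fun h => hp (hKO h)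
    have hz : (fun p : Spacetime d × Spacetime d => θ p * (f₁ p.1 : ℂ) * (f₂ p.2 : ℂ)) =ᶠ[𝓝 p]
        fun _ => 0 := eventually_of_mem (hK.isClosed.isOpen_compl.mem_nhds hpK) hS0
    beta_reduce
    rw [hz.fderiv_eq, fderiv_fun_const, mul_assoc, mul_assoc, h0 _ hv p hpK,
      h0 f₂ Subset.rfl p hpK]
    simp

theorem exists_smooth_kernel_boundaryIntegral (hd : 1 ≤ d) {m2 : ℝ} {E : Distr d}
    (hE : IsFeynmanParametrix m2 E) {B₁ B₂ : Set (Spacetime d)} (hB₁ : IsCompact B₁)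
    (hB : NullConvex B₁) (hB₂ : IsCompact B₂) {χ : Spacetime d → ℝ} (hχ : ContDiff ℝ ∞ χ)
    (hχ₁ : ∀ y ∈ B₁, χ y = 1) (hχ₂ : ∀ y ∉ B₂, χ y = 0) :
    ∃ θ : Spacetime d × Spacetime d → ℂ, ContDiffOn ℝ ∞ θ (interior B₁ ×ˢ interior B₁) ∧
      ∀ f₁ f₂ : Test d, tsupport f₁ ⊆ interior B₁ → tsupport f₂ ⊆ interior B₁ →
        boundaryIntegral E χ B₁ B₂ f₁ f₂ =
          ∫ p : Spacetime d × Spacetime d, θ p * (f₁ p.1 : ℂ) * (f₂ p.2 : ℂ) := by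
  obtain ⟨U, V, W, ℓ, hU, hV, hW, hℓ, -, hlim⟩ := hE.hadamard_form
  obtain ⟨a, F, ha, hF, heq⟩ := exists_regularizedKernel_eq hU hV hW hℓ hd
  have hlim' : ∀ f : Test d, Tendsto (fun ε : ℝ => ∫ x, hadamardSum a F ε x * (f x : ℂ)) (𝓝[>] 0)
      (𝓝 (E f)) := fun f => (hlim f).congr' (by
    filter_upwards [self_mem_nhdsWithin] with ε hε
    simp only [heq ε hε])
  have hχd : Differentiable ℝ χ := hχ.differentiable (by simp)
  have hψ : ∀ μ : Fin (d + 1), ContDiff ℝ ∞ fun y => fderiv ℝ χ y (basisVec μ) := fun μ =>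
    (hχ.fderiv_right (m := ∞) (by simp)).clm_apply contDiff_const
  have hχc : HasCompactSupport χ := HasCompactSupport.intro hB₂ hχ₂
  have hψc : ∀ μ : Fin (d + 1), HasCompactSupport fun y => fderiv ℝ χ y (basisVec μ) :=
    fun μ => hχc.fderiv_apply ℝ (basisVec μ)
  have hψB : ∀ μ : Fin (d + 1),
      Disjoint (tsupport fun y => fderiv ℝ χ y (basisVec μ)) (interior B₁) := fun μ => by
    refine Disjoint.closure_left (disjoint_left.2 fun y hy hyB => hy ?_) isOpen_interior
    change fderiv ℝ χ y (basisVec μ) = 0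
    have : χ =ᶠ[𝓝 y] fun _ => 1 :=
      eventually_of_mem (isOpen_interior.mem_nhds hyB) fun x hx => hχ₁ x (interior_subset hx)
    rw [this.fderiv_eq, fderiv_fun_const]
    rfl
  choose θ hθ hθE using fun μ => exists_smooth_kernel ha hF hlim' hB (hψ μ) (hψc μ) (hψB μ)
  have hO : IsOpen (interior B₁ ×ˢ interior B₁) := isOpen_interior.prod isOpen_interior
  -- Each `θ μ` is the kernel for the weight `∂_μ χ`; moving `∂_μ` from `f₂` onto it yields the
  -- minus sign.
  refine ⟨fun p => ∑ μ, -(eta μ : ℂ) * fderiv ℝ (θ μ) p (0, basisVec μ),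
    ContDiffOn.sum fun μ _ => contDiffOn_const.mul
      (((hθ μ).fderiv_of_isOpen hO (by simp)).clm_apply contDiffOn_const), fun f₁ f₂ h₁ h₂ => ?_⟩
  have hcont : ∀ μ : Fin (d + 1), Continuous fun y => ((fderiv ℝ χ y (basisVec μ) : ℝ) : ℂ) *
      (smeared E f₁ y * smeared E (∂_{basisVec μ} f₂) y) := fun μ =>
    (Complex.continuous_ofReal.comp (hψ μ).continuous).mul
      ((contDiff_smeared E f₁).continuous.mul (contDiff_smeared E _).continuous)
  have hcs : ∀ μ : Fin (d + 1), HasCompactSupport fun y =>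
      ((fderiv ℝ χ y (basisVec μ) : ℝ) : ℂ) *
      (smeared E f₁ y * smeared E (∂_{basisVec μ} f₂) y) := fun μ =>
    ((hψc μ).comp_left (g := fun r : ℝ => (r : ℂ)) Complex.ofReal_zero).mul_right
  have hparts := fun μ : Fin (d + 1) =>
    integral_mul_lineDeriv_right isOpen_interior (hθ μ) f₁ f₂ h₁ h₂ (basisVec μ)
  calc boundaryIntegral E χ B₁ B₂ f₁ f₂
      = ∫ y, ∑ μ : Fin (d + 1), (eta μ : ℂ) * (((fderiv ℝ χ y (basisVec μ) : ℝ) : ℂ) *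
        (smeared E f₁ y * smeared E (∂_{basisVec μ} f₂) y)) := by
        rw [boundaryIntegral, setIntegral_diff_eq_integral hB₁ hB₂ hχd hχ₁ hχ₂]
        · refine integral_congr_ae (Eventually.of_forall fun y => Finset.sum_congr rfl fun μ _ => ?_)
          rw [fderiv_smeared_apply]
          ring
        · intro y hy
          simp [hy]
    _ = ∑ μ : Fin (d + 1), (eta μ : ℂ) * ∫ y, ((fderiv ℝ χ y (basisVec μ) : ℝ) : ℂ) *
        (smeared E f₁ y * smeared E (∂_{basisVec μ} f₂) y) := by
        rw [integral_finsetSum _ fun μ _ =>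
          ((hcont μ).integrable_of_hasCompactSupport (hcs μ)).const_mul _]
        exact Finset.sum_congr rfl fun μ _ => integral_const_mul _ _
    _ = ∑ μ : Fin (d + 1), -(eta μ : ℂ) * ∫ p : Spacetime d × Spacetime d,
        fderiv ℝ (θ μ) p (0, basisVec μ) * (f₁ p.1 : ℂ) * (f₂ p.2 : ℂ) := by
        refine Finset.sum_congr rfl fun μ _ => ?_
        rw [hθE μ f₁ _ h₁ ((tsupport_lineDeriv_subset f₂ _).trans h₂), (hparts μ).2]
        ring
    _ = _ := by
        simp_rw [← integral_const_mul]
        rw [← integral_finsetSum _ fun μ _ => (hparts μ).1.const_mul _]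
        refine integral_congr_ae (Eventually.of_forall fun p => ?_)
        simp only [Finset.sum_mul, mul_assoc]

end BoundaryIntegral

end MinkowskiFlow

end

theorem mainTheorem12 (d : ℕ) (hd : 1 ≤ d) (m2 : ℝ)
    (E : MinkowskiFlow.Distr d) (hE : MinkowskiFlow.IsFeynmanParametrix m2 E)
    (z : MinkowskiFlow.Spacetime d) (B₁ B₂ : Set (MinkowskiFlow.Spacetime d))
    (hB₁ : IsCompact B₁) (hz₁ : B₁ ∈ 𝓝 z) (hB₁_null : MinkowskiFlow.NullConvex B₁)
    (hB₂ : IsCompact B₂) (hz₂ : B₂ ∈ 𝓝 z)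
    (χ : MinkowskiFlow.Spacetime d → ℝ) (hχ : ContDiff ℝ ∞ χ)
    (hχ₁ : ∀ y ∈ B₁, χ y = 1) (hχ₂ : ∀ y ∉ B₂, χ y = 0) :
    (∀ f : MinkowskiFlow.Test d, ContDiff ℝ ∞ (MinkowskiFlow.smeared E f)) ∧
    ∃ θ : MinkowskiFlow.Spacetime d × MinkowskiFlow.Spacetime d → ℂ,
      ContDiffOn ℝ ∞ θ (interior B₁ ×ˢ interior B₁) ∧
      ∀ f₁ f₂ : MinkowskiFlow.Test d,
        tsupport f₁ ⊆ interior B₁ → tsupport f₂ ⊆ interior B₁ →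
        MinkowskiFlow.boundaryIntegral E χ B₁ B₂ f₁ f₂ =
          ∫ p : MinkowskiFlow.Spacetime d × MinkowskiFlow.Spacetime d,
            θ p * (f₁ p.1 : ℂ) * (f₂ p.2 : ℂ) := by
  exact ⟨MinkowskiFlow.contDiff_smeared E,
    MinkowskiFlow.exists_smooth_kernel_boundaryIntegral hd hE hB₁
      hB₁_null hB₂ hχ hχ₁ hχ₂⟩
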